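/- **Setting.** Let $d\ge 3$, $T\ge 2$, $G>0$. Let $\mathcal X=\{x\in\mathbb R^d: x\ge 0,\ \|x\|_1=1\}$, $c=(1/d,\dots,1/d)$, $\psi(x)=\sum_j x^{(j)}\log x^{(j)}$ (with $0\log 0=0$), $B_\psi(x;y)=\psi(x)-\psi(y)-\langle\nabla\psi(y),x-y\rangle$, $F_\psi=\sup_{\mathcal X}\psi-\inf_{\mathcal X}\psi$. For $\mu\in(0,1)$ let $\mathcal X_\mu=\{(1-\mu)x+\mu c: x\in\mathcal X\}$ and $G_\psi=\sup_{x\in\mathcal X_\mu}\|\nabla\psi(x)\|_\infty$. Let $u_1,\dots,u_{T+1}\in\mathcal X$ and $P_{T,1}=\sum_{t=1}^T\|u_{t+1}-u_t\|_1$. Let $f_1,\dots,f_T:\mathbb R^d\to\mathbb R$ be convex and satisfy $|f_t(x)-f_t(y)|\le G\|x-y\|_1$ for all $x,y$ in the neighbourhood $\{x:\exists z\in\mathcal X,\ \|x-z\|_1\le\mu\}$ of $\mathcal X$. The $f_t$ and $u_t$ are deterministic. **Algorithm (PBMD).** The inputs are $\mu\in(0,1)$, $\gamma>0$, $N\ge1$,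 step sizes $\eta_{(1)},\dots,\eta_{(N)}$ and initial points $y_{(k),1}\in\mathcal X_\mu$. Set $\omega_{(k),1}=\frac{N+1}{N}\frac1{k(k+1)}$. In round $t=1,\dots,T$: put $y_t=\sum_{k=1}^N\omega_{(k),t}y_{(k),t}$, draw $s_t$ from the uniform distribution on the sphere $\{\|s\|_1=1\}$, independently of the other rounds, play $x_t^\pm=y_t\pm\mu s_t$, and set $$g_t=\frac{d}{2\mu}\bigl(f_t(x_t^+)-f_t(x_t^-)\bigr)\,\mathrm{sign}(s_t)\qquad(\text{componentwise},\ \mathrm{sign}(0)=1).$$ With $\varphi_t(y)=\langle g_t,y-y_t\rangle$, update $$\omega_{(k),t+1}=\frac{\omega_{(k),t}e^{-\gamma\varphi_t(y_{(k),t})}}{\sum_{j=1}^N\omega_{(j),t}e^{-\gamma\varphi_t(y_{(j),t})}},\qquad y_{(k),t+1}=\operatorname*{argmin}_{y\in\mathcal X_\mu}\ \langle g_t,y\rangle+\frac1{\eta_{(k)}}B_\psi(y;y_{(k),t}).$$ **Parameters.** Fix constants $0<a\le b$ and $\kappa\ge1$. Let $v_1=(1-\mu)u_1+\mu c$, and let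 $D$ be a number with $$F_\psi+B_\psi(v_1;y_1)\ \le\ D\ \le\ \kappa\bigl(F_\psi+B_\psi(v_1;y_1)\bigr).$$ (For example $D=F_\psi+B_\psi(v_1;y_1)$; or, if all base learners start at $c$ and $\kappa\ge2$, $D=2\log d$, which does not depend on the comparators.) Let $$\eta_{(k)}=2^{k-1}\sqrt{\frac{D}{6(1+\sqrt2)^2G^2dT}}\ (k=1,\dots,N),\qquad N=\Bigl\lceil\tfrac12\log_2\Bigl(1+\frac{2G_\psi T}{D}\Bigr)\Bigr\rceil+1,$$ $$\frac{a}{G\sqrt{dT}}\le\gamma\le\frac{b}{G\sqrt{dT}},\qquad a\min\Bigl\{1,\sqrt{Dd/T}\Bigr\}\le\mu\le b\sqrt{Dd/T},\qquad 0<\mu<1.$$ **Claim.** For all $0<a\le b$ and $\kappa\ge1$ there is a constant $C>0$, depending only on $a,b,\kappa$, such that in every such situation the dynamic regret is integrable and $$\mathbb E\left[\sum_{t=1}^T\frac{f_t(x_t^+)+f_t(x_t^-)}2-f_t(u_t)\right]\le C\,G\sqrt{d\log(d)\,T\log(T)\,(1+P_{T,1})},$$ where the expectation is over $s_1,\dots,s_T$.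 -/

import Mathlib

open MeasureTheory ProbabilityTheory

noncomputable section

/-- The `ℓ₁`-norm on `ℝ^d`. -/
def l1norm {d : ℕ} (x : Fin d → ℝ) : ℝ := ∑ i, |x i|

/-- The sign vector of `x`, with the convention `sign 0 = 1`. -/
def signVec {d : ℕ} (x : Fin d → ℝ) : Fin d → ℝ := fun i => if 0 ≤ x i then 1 else -1

/-- The uniform distribution on the unit `ℓ₁`-sphere: the law of `x / ‖x‖₁` for `x` uniform on the
open unit `ℓ₁`-ball. All facets of the cross-polytope have the same distance to the origin, so this
is the normalized surface measure of the `ℓ₁`-sphere. -/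
def unifL1Sphere (d : ℕ) : Measure (Fin d → ℝ) :=
  ((volume : Measure (Fin d → ℝ))[|{x | l1norm x < 1}]).map (fun x => (l1norm x)⁻¹ • x)

/-- The gradient, as the vector of partial derivatives. -/
def gradVec {d : ℕ} (ψ : (Fin d → ℝ) → ℝ) (x : Fin d → ℝ) : Fin d → ℝ :=
  fun j => fderiv ℝ ψ x (Pi.single j 1)

/-- The Bregman divergence `B_ψ(x; y) = ψ(x) - ψ(y) - ⟨∇ψ(y), x - y⟩`. -/
def bregman {d : ℕ} (ψ : (Fin d → ℝ) → ℝ) (x y : Fin d → ℝ) : ℝ :=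
  ψ x - ψ y - gradVec ψ y ⬝ᵥ (x - y)

open Classical in
/-- A minimizer of `F` over `S` (a junk value if there is none). -/
def argminOn {d : ℕ} (S : Set (Fin d → ℝ)) (F : (Fin d → ℝ) → ℝ) : Fin d → ℝ :=
  if h : ∃ y, y ∈ S ∧ IsMinOn F S y then h.choose else 0

/-- The inputs of the parameter-free bandit mirror descent algorithm. Base learners are numbered
`k = 1, …, N`; the values of `stepSize` and `init` at other indices are irrelevant. -/
structure PBMDInput (d : ℕ) where
  /-- the divergence-generating function -/
  ψ : (Fin d → ℝ) → ℝ
  /-- the shrunk feasible set, over which the base learners minimize -/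
  dom : Set (Fin d → ℝ)
  /-- the number of base learners -/
  N : ℕ
  /-- the smoothing parameter -/
  μ : ℝ
  /-- the weight update parameter -/
  γ : ℝ
  /-- the candidate step sizes -/
  stepSize : ℕ → ℝ
  /-- the initial iterates of the base learners -/
  init : ℕ → (Fin d → ℝ)

/-- The state at the beginning of a round: iterates and weights of the base learners. -/
structure PBMDState (d : ℕ) where
  iter : ℕ → (Fin d → ℝ)
  weight : ℕ → ℝ

namespace PBMDInput

variable {d : ℕ} (A : PBMDInput d)

/-- The state before the first round, with weights `(N + 1) / N * 1 / (k (k + 1))`. -/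
def initState : PBMDState d where
  iter := A.init
  weight := fun k => ((A.N : ℝ) + 1) / A.N * (1 / ((k : ℝ) * (k + 1)))

/-- The combined decision of the meta learner: the weighted sum of the base iterates. -/
def combine (st : PBMDState d) : Fin d → ℝ :=
  ∑ k ∈ Finset.Icc 1 A.N, st.weight k • st.iter k

/-- The two-point gradient estimator of the loss `f` with the sampled direction `s`. -/
def estimator (st : PBMDState d) (f : (Fin d → ℝ) → ℝ) (s : Fin d → ℝ) : Fin d → ℝ :=
  ((d : ℝ) / (2 * A.μ) * (f (A.combine st + A.μ • s) - f (A.combine st - A.μ • s))) • signVec s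

/-- The linear surrogate loss `z ↦ ⟨g, z - y⟩`, with `g` the estimator and `y` the combined
decision. -/
def surrogate (st : PBMDState d) (f : (Fin d → ℝ) → ℝ) (s : Fin d → ℝ) (z : Fin d → ℝ) : ℝ :=
  A.estimator st f s ⬝ᵥ (z - A.combine st)

/-- One round: multiplicative update of the weights, and a mirror descent step of every base
learner (the gradient of the surrogate is the estimator). -/
def step (st : PBMDState d) (f : (Fin d → ℝ) → ℝ) (s : Fin d → ℝ) : PBMDState d where
  iter := fun k => argminOn A.dom
    (fun z => A.estimator st f s ⬝ᵥ z + 1 / A.stepSize k * bregman A.ψ z (st.iter k))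
  weight := fun k =>
    st.weight k * Real.exp (-A.γ * A.surrogate st f s (st.iter k)) /
      ∑ j ∈ Finset.Icc 1 A.N, st.weight j * Real.exp (-A.γ * A.surrogate st f s (st.iter j))

/-- The state before round `t + 1`, where `f t` and `s t` are the loss and the sampled direction of
round `t + 1` (rounds are numbered `1, …, T`). -/
def state (f : ℕ → (Fin d → ℝ) → ℝ) (s : ℕ → (Fin d → ℝ)) : ℕ → PBMDState d
  | 0 => A.initState
  | t + 1 => A.step (state f s t) (f t) (s t)

/-- The dynamic regret against `u` after `T` rounds, when the sampled directions are `s`: the sum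
of `(f(y + μ s) + f(y - μ s)) / 2 - f(u)` over the rounds, with `y` the combined decision. -/
def dynamicRegret (T : ℕ) (f : ℕ → (Fin d → ℝ) → ℝ) (u : ℕ → (Fin d → ℝ))
    (s : ℕ → (Fin d → ℝ)) : ℝ :=
  ∑ t ∈ Finset.range T,
    ((f t (A.combine (A.state f s t) + A.μ • s t) +
      f t (A.combine (A.state f s t) - A.μ • s t)) / 2 - f t (u t))

end PBMDInput

/-- The path variation `∑ ‖u_{t+1} - u_t‖₁` over `T` steps, for a sequence indexed from `0`. -/
def pathVariation {d : ℕ} (T : ℕ) (u : ℕ → (Fin d → ℝ)) : ℝ :=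
  ∑ t ∈ Finset.range T, l1norm (u (t + 1) - u t)

/-- The negative entropy, with `0 log 0 = 0`. -/
def negEntropy {d : ℕ} (x : Fin d → ℝ) : ℝ := ∑ j, x j * Real.log (x j)

/-- The point `(1 - α) x + α c`, with `c = (1/d, …, 1/d)` the centroid of the simplex. -/
def shrinkPoint {d : ℕ} (α : ℝ) (x : Fin d → ℝ) : Fin d → ℝ :=
  (1 - α) • x + α • (fun _ => 1 / (d : ℝ))

/-- The shrunk simplex `{(1 - α) x + α c : x in the simplex}`. -/
def shrunkSimplex (d : ℕ) (α : ℝ) : Set (Fin d → ℝ) := shrinkPoint α '' stdSimplex ℝ (Fin d)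

/-- The closed `ℓ₁`-neighbourhood of radius `μ` of the simplex. -/
def simplexNhd (d : ℕ) (μ : ℝ) : Set (Fin d → ℝ) :=
  {x | ∃ y ∈ stdSimplex ℝ (Fin d), l1norm (x - y) ≤ μ}

/-- The oscillation `sup ψ - inf ψ` of the negative entropy over the simplex. -/
def entropyOsc (d : ℕ) : ℝ :=
  sSup (negEntropy '' stdSimplex ℝ (Fin d)) - sInf (negEntropy '' stdSimplex ℝ (Fin d))

/-- The supremum of `‖∇ψ‖_∞` over the shrunk simplex, which contains all iterates (the norm of
`Fin d → ℝ` is the sup norm). -/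
def entropyGradBound (d : ℕ) (α : ℝ) : ℝ :=
  sSup ((fun x : Fin d → ℝ => ‖gradVec negEntropy x‖) '' shrunkSimplex d α)

/-- The constant `F_ψ + B_ψ(v₁; y₁)`, where `v₁ = (1 - μ) u₁ + μ c` and `y₁` is the first combined
decision. -/
def initialGap {d : ℕ} (A : PBMDInput d) (u₁ : Fin d → ℝ) : ℝ :=
  entropyOsc d + bregman negEntropy (shrinkPoint A.μ u₁) (A.combine A.initState)

/-- The parameter setting for the simplex with the negative entropy, `p = q = 1`, shrinkage
`α = μ`, strong convexity modulus `1` and radius `R = 1`. The learner uses a value `D` for the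
constant `F_ψ + B_ψ(v₁; y₁)` that is exact (always allowed) or overestimates it by at most the
factor `κ`. The orders of magnitude prescribed for `γ` and `μ` are met up to constant factors
between `a` and `b`; as `μ < 1` is needed, the lower bound on `μ` is only required up to the value
`1` of its order of magnitude. -/
structure SimplexSetting (a b κ : ℝ) {d : ℕ} (T : ℕ) (G D : ℝ) (u₁ : Fin d → ℝ)
    (A : PBMDInput d) : Prop where
  mirror : A.ψ = negEntropy
  μ_pos : 0 < A.μ
  μ_lt_one : A.μ < 1
  dom : A.dom = shrunkSimplex d A.μ
  init_mem : ∀ k ∈ Finset.Icc 1 A.N, A.init k ∈ shrunkSimplex d A.μ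
  gap_le : initialGap A u₁ ≤ D
  le_gap : D ≤ κ * initialGap A u₁
  num : A.N = ⌈1 / 2 * Real.logb 2 (1 + 2 * entropyGradBound d A.μ * T / D)⌉₊ + 1
  steps : ∀ k ∈ Finset.Icc 1 A.N,
    A.stepSize k = 2 ^ (k - 1) * √(D / (6 * (1 + √2) ^ 2 * G ^ 2 * d * T))
  γ_lower : a * (1 / (G * √(d * T))) ≤ A.γ
  γ_upper : A.γ ≤ b * (1 / (G * √(d * T)))
  μ_lower : a * min 1 (√(D * d / T)) ≤ A.μ
  μ_upper : A.μ ≤ b * √(D * d / T)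

end

/-!
The proof compares the algorithm with a single base learner, chosen in terms of the path variation.

*Deterministic part.* On the surrogate losses, each base learner has the usual dynamic regret of
mirror descent, `(B(v₁; y) + osc ψ + Γ · path) / η + η ∑ ‖g‖²`
(`PBMDInput.IsEntropic.base_regret`); it rests on strong convexity of the entropy in the `ℓ₁`-norm
(`sq_l1norm_sub_le_bregman`). The multiplicative weights cost at most
`log (1 / ω) / γ + 4 γ ∑ ‖g‖²` on top (`PBMDInput.IsEntropic.meta_regret`), because the surrogate
losses have weighted mean zero and `exp x ≤ x + exp (x ^ 2)`.

*The estimator.* For a convex loss, the mean of the two-point estimator is a subgradient of the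
average of the loss over `ℓ₁`-balls (`sub_le_integral_estimator`). No smoothness is needed: by
convexity the increment `f y - f v` is at most a difference quotient of the ball average, and in
polar coordinates with respect to the `ℓ₁`-norm (`map_smul_unifL1Sphere_prod_l1Radial`) the
difference of the integrals over a ball and its translate is an integral over the sphere, in the
limit of small translations.

*Its second moment* is of order `G² d` instead of the trivial `G² d²`
(`integral_norm_estimator_sq_le`). The uniform distribution on the `ℓ₁`-sphere is invariant under
changes of signs, so the Efron–Stein inequality on the cube of signs (`cube_variance_le`) bounds
`E (h s - h (-s))²` by `4 L² E ‖s‖₂²`, and `E ‖s‖₂² = 2 / (d + 1)` follows by comparison with the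
product measure of density `exp (-‖x‖₁)` in polar coordinates.

*Probability.* The iterates depend measurably on the directions sampled so far, since the mirror
descent step is a Lipschitz function of its linear part (`continuous_mirrorMap`); hence the decision
of a round is independent of the direction sampled in it
(`PBMDInput.IsEntropic.indepFun_combine`), and the two moment bounds can be integrated.

*Tuning.* With `Γ` the gradient bound of the entropy and `P` the path variation, the step size
balancing the two terms is the smallest one times `R`, where `R ^ 2 = 1 + Γ (1 + P) / (2 D)`; the
grid contains it up to a factor two (`exists_grid_index`). All terms are then of order
`G √(d T) √(D + Γ (1 + P))`, and `D` and `Γ` are of order `log d + log T`, which is at most a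
constant times `log d · log T`.
-/

open scoped Pointwise Topology

noncomputable section

/-! ### The `ℓ₁`-norm and sign vectors -/

theorem l1norm_nonneg {d : ℕ} (x : Fin d → ℝ) : 0 ≤ l1norm x :=
  Finset.sum_nonneg fun _ _ => abs_nonneg _

theorem l1norm_add_le {d : ℕ} (x y : Fin d → ℝ) : l1norm (x + y) ≤ l1norm x + l1norm y := by
  unfold l1norm
  rw [← Finset.sum_add_distrib]
  exact Finset.sum_le_sum fun i _ => abs_add_le _ _

theorem l1norm_smul {d : ℕ} (r : ℝ) (x : Fin d → ℝ) : l1norm (r • x) = |r| * l1norm x := by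
  simp [l1norm, abs_mul, Finset.mul_sum]

theorem l1norm_neg {d : ℕ} (x : Fin d → ℝ) : l1norm (-x) = l1norm x := by simp [l1norm]

theorem l1norm_sub_comm {d : ℕ} (x y : Fin d → ℝ) : l1norm (x - y) = l1norm (y - x) := by
  simp [l1norm, abs_sub_comm]

theorem l1norm_sub_le {d : ℕ} (x y : Fin d → ℝ) : l1norm (x - y) ≤ l1norm x + l1norm y := by
  rw [sub_eq_add_neg, ← l1norm_neg y]
  exact l1norm_add_le _ _

theorem continuous_l1norm {d : ℕ} : Continuous (l1norm (d := d)) := by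
  unfold l1norm; fun_prop

theorem measurable_signVec {d : ℕ} : Measurable (signVec (d := d)) := by
  refine measurable_pi_lambda _ fun i => ?_
  exact Measurable.ite (measurableSet_le measurable_const (measurable_pi_apply i))
    measurable_const measurable_const

theorem abs_signVec {d : ℕ} (x : Fin d → ℝ) (i : Fin d) : |signVec x i| = 1 := by
  unfold signVec; split_ifs <;> simp

/-- Hölder's inequality for the pair `ℓ∞`, `ℓ₁`. -/
theorem abs_dotProduct_le {d : ℕ} (g x : Fin d → ℝ) : |g ⬝ᵥ x| ≤ ‖g‖ * l1norm x := by
  unfold dotProduct l1norm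
  rw [Finset.mul_sum]
  refine (Finset.abs_sum_le_sum_abs _ _).trans (Finset.sum_le_sum fun i _ => ?_)
  rw [abs_mul]
  exact mul_le_mul_of_nonneg_right (norm_le_pi_norm g i) (abs_nonneg _)

theorem norm_signVec_le {d : ℕ} (x : Fin d → ℝ) : ‖signVec x‖ ≤ 1 :=
  (pi_norm_le_iff_of_nonneg zero_le_one).2 fun i => (abs_signVec x i).le

/-- `signVec x` is a subgradient of the `ℓ₁`-norm at `x`. -/
theorem l1norm_add_signVec_le {d : ℕ} (x w : Fin d → ℝ) :
    l1norm x + signVec x ⬝ᵥ w ≤ l1norm (x + w) := by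
  unfold l1norm dotProduct
  rw [← Finset.sum_add_distrib]
  refine Finset.sum_le_sum fun i _ => ?_
  simp only [signVec, Pi.add_apply]
  split_ifs with h
  · rw [abs_of_nonneg h, one_mul]; exact le_abs_self _
  · rw [abs_of_neg (not_le.1 h)]; linarith [neg_abs_le (x i + w i)]

theorem signVec_smul_of_pos {d : ℕ} {r : ℝ} (hr : 0 < r) (x : Fin d → ℝ) :
    signVec (r • x) = signVec x := by
  ext i; simp [signVec, hr]

theorem signVec_neg {d : ℕ} {x : Fin d → ℝ} (hx : ∀ i, x i ≠ 0) :
    signVec (-x) = -signVec x := by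
  ext i
  simp only [signVec, Pi.neg_apply, Left.nonneg_neg_iff]
  rcases lt_or_gt_of_ne (hx i) with h | h
  · simp [h.le, h.not_ge]
  · simp [h.le, h.not_ge]

/-! ### The uniform distribution on the `ℓ₁`-sphere -/

/-- The open unit ball of the `ℓ₁`-norm. -/
def l1Ball (d : ℕ) : Set (Fin d → ℝ) := {x | l1norm x < 1}

theorem measurableSet_l1Ball (d : ℕ) : MeasurableSet (l1Ball d) :=
  (isOpen_lt continuous_l1norm continuous_const).measurableSet

theorem l1norm_toLp {d : ℕ} (x : PiLp 1 (fun _ : Fin d => ℝ)) : ‖x‖ = l1norm (WithLp.ofLp x) := by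
  rw [PiLp.norm_eq_of_L1]; rfl

/-- Lebesgue measure, transported to `ℝ^d` with the `ℓ₁`-norm. -/
def l1Volume (d : ℕ) : Measure (PiLp 1 (fun _ : Fin d => ℝ)) :=
  (volume : Measure (Fin d → ℝ)).map (WithLp.toLp 1)

instance (d : ℕ) : (l1Volume d).IsAddHaarMeasure :=
  (PiLp.continuousLinearEquiv 1 ℝ (fun _ : Fin d => ℝ)).symm.isAddHaarMeasure_map volume

theorem measurable_toLp_one {d : ℕ} :
    Measurable (WithLp.toLp 1 : (Fin d → ℝ) → PiLp 1 (fun _ : Fin d => ℝ)) :=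
  (PiLp.continuous_toLp 1 _).measurable

theorem measurable_ofLp_one {d : ℕ} :
    Measurable (WithLp.ofLp : PiLp 1 (fun _ : Fin d => ℝ) → (Fin d → ℝ)) :=
  (PiLp.continuous_ofLp 1 _).measurable

theorem map_ofLp_l1Volume (d : ℕ) : (l1Volume d).map WithLp.ofLp = volume := by
  rw [l1Volume, Measure.map_map measurable_ofLp_one measurable_toLp_one]
  exact Measure.map_id

theorem l1Volume_ball (d : ℕ) : l1Volume d (Metric.ball 0 1) = volume (l1Ball d) := by
  rw [l1Volume, Measure.map_apply measurable_toLp_one Metric.isOpen_ball.measurableSet]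
  congr 1
  ext x
  simp [l1Ball, l1norm_toLp]

theorem volume_l1Ball_lt_top (d : ℕ) : volume (l1Ball d) < ⊤ := by
  rw [← l1Volume_ball]; exact measure_ball_lt_top

theorem volume_l1Ball_pos (d : ℕ) : 0 < volume (l1Ball d) := by
  rw [← l1Volume_ball]; exact Metric.measure_ball_pos _ _ one_pos

/-- Normalization `x ↦ x / ‖x‖₁`. -/
def l1Normalize {d : ℕ} (x : Fin d → ℝ) : Fin d → ℝ := (l1norm x)⁻¹ • x

theorem measurable_l1Normalize {d : ℕ} : Measurable (l1Normalize (d := d)) :=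
  (continuous_l1norm.measurable.inv).smul measurable_id

theorem unifL1Sphere_eq (d : ℕ) :
    unifL1Sphere d = (volume[|l1Ball d]).map l1Normalize := rfl

instance (d : ℕ) : IsProbabilityMeasure (unifL1Sphere d) := by
  have : IsProbabilityMeasure ((volume : Measure (Fin d → ℝ))[|l1Ball d]) :=
    cond_isProbabilityMeasure_of_finite (volume_l1Ball_pos d).ne' (volume_l1Ball_lt_top d).ne
  rw [unifL1Sphere_eq]
  exact Measure.isProbabilityMeasure_map measurable_l1Normalize.aemeasurable

/-- The surface measure of the `ℓ₁`-sphere, as a measure on `ℝ^d`. -/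
def l1Surface (d : ℕ) : Measure (Fin d → ℝ) :=
  (l1Volume d).toSphere.map
    (fun s : Metric.sphere (0 : PiLp 1 (fun _ : Fin d => ℝ)) 1 => WithLp.ofLp s.1)

theorem measurable_ofLp_sphere {d : ℕ} :
    Measurable (fun s : Metric.sphere (0 : PiLp 1 (fun _ : Fin d => ℝ)) 1 => WithLp.ofLp s.1) :=
  measurable_ofLp_one.comp measurable_subtype_coe

theorem finrank_l1 (d : ℕ) : Module.finrank ℝ (PiLp 1 (fun _ : Fin d => ℝ)) = d := by
  rw [(WithLp.linearEquiv 1 ℝ (Fin d → ℝ)).finrank_eq, Module.finrank_fin_fun]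

theorem l1Surface_apply {d : ℕ} (hd : 0 < d) {A : Set (Fin d → ℝ)} (hA : MeasurableSet A) :
    l1Surface d A = d * volume (l1Ball d ∩ l1Normalize ⁻¹' A) := by
  have : Nonempty (Fin d) := ⟨⟨0, hd⟩⟩
  rw [l1Surface, Measure.map_apply measurable_ofLp_sphere hA,
    Measure.toSphere_apply' _ (measurable_ofLp_sphere hA)]
  congr 1
  · rw [finrank_l1]
  · have : l1Volume d = volume.map (MeasurableEquiv.toLp 1 (Fin d → ℝ)) := rfl
    rw [this, MeasurableEquiv.map_apply]
    have hset : (l1Ball d ∩ l1Normalize ⁻¹' A) \ {0} =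
        (MeasurableEquiv.toLp 1 (Fin d → ℝ)) ⁻¹' (Set.Ioo (0 : ℝ) 1 • (Subtype.val ''
          ((fun s : Metric.sphere (0 : PiLp 1 (fun _ : Fin d => ℝ)) 1 => WithLp.ofLp s.1) ⁻¹' A))) := by
      ext x
      constructor
      · rintro ⟨⟨h1, h2⟩, h3⟩
        have hx : 0 < l1norm x := by
          refine lt_of_le_of_ne (l1norm_nonneg x) fun h => h3 ?_
          have h' : ‖(WithLp.toLp 1 x : PiLp 1 (fun _ : Fin d => ℝ))‖ = 0 := by
            rw [l1norm_toLp]; exact h.symm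
          have := norm_eq_zero.1 h'
          simpa using this
        refine Set.mem_smul.2 ⟨l1norm x, ⟨hx, h1⟩, WithLp.toLp 1 (l1Normalize x),
          ⟨⟨WithLp.toLp 1 (l1Normalize x), ?_⟩, h2, rfl⟩, ?_⟩
        · simp [l1norm_toLp, l1Normalize, l1norm_smul, abs_of_pos hx, hx.ne']
        · simp [l1Normalize, smul_smul, hx.ne', ← WithLp.toLp_smul]
      · rintro ⟨r, ⟨hr0, hr1⟩, _, ⟨⟨y, hy⟩, hyA, rfl⟩, hxy⟩
        have hx : x = r • WithLp.ofLp y := by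
          have := congrArg WithLp.ofLp hxy
          simpa using this.symm
        have hy1 : l1norm (WithLp.ofLp y) = 1 := by
          rw [← l1norm_toLp]; simpa using hy
        have hlx : l1norm x = r := by rw [hx, l1norm_smul, hy1, abs_of_pos hr0, mul_one]
        refine ⟨⟨?_, ?_⟩, ?_⟩
        · simpa [l1Ball, hlx] using hr1
        · have : l1Normalize x = WithLp.ofLp y := by
            rw [l1Normalize, hlx, hx, smul_smul, inv_mul_cancel₀ hr0.ne', one_smul]
          simpa [this] using hyA
        · rintro rfl
          simp [l1norm] at hlx
          exact hr0.ne hlx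
    rw [← hset, measure_sdiff_null]
    simp

theorem l1Surface_eq {d : ℕ} (hd : 0 < d) :
    l1Surface d = (d * volume (l1Ball d)) • unifL1Sphere d := by
  ext A hA
  rw [l1Surface_apply hd hA, unifL1Sphere_eq, Measure.smul_apply,
    Measure.map_apply measurable_l1Normalize hA, cond_apply (measurableSet_l1Ball d), smul_eq_mul,
    mul_assoc, ← mul_assoc (volume _) (volume _)⁻¹,
    ENNReal.mul_inv_cancel (volume_l1Ball_pos d).ne' (volume_l1Ball_lt_top d).ne, one_mul]

/-- The radial part of Lebesgue measure in the polar decomposition with respect to the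
`ℓ₁`-norm: density `d · vol(B) · r ^ (d - 1)` on the positive half-line. -/
def l1Radial (d : ℕ) : Measure ℝ :=
  (volume.restrict (Set.Ioi 0)).withDensity
    fun r => ENNReal.ofReal (d * volume.real (l1Ball d) * r ^ (d - 1))

theorem l1Radial_eq (d : ℕ) : l1Radial d =
    (d * volume (l1Ball d)) • (Measure.volumeIoiPow (d - 1)).map Subtype.val := by
  have hm : Measurable fun r : ℝ => ENNReal.ofReal (r ^ (d - 1)) := by fun_prop
  have h1 : (Measure.volumeIoiPow (d - 1)).map Subtype.val =
      (volume.restrict (Set.Ioi 0)).withDensity fun r : ℝ => ENNReal.ofReal (r ^ (d - 1)) := by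
    ext A hA
    rw [Measure.map_apply measurable_subtype_coe hA, Measure.volumeIoiPow,
      withDensity_apply _ (measurable_subtype_coe hA), withDensity_apply _ hA,
      Measure.restrict_restrict hA,
      setLIntegral_subtype measurableSet_Ioi _ fun a : ℝ ↦ .ofReal (a ^ (d - 1)),
      Subtype.image_preimage_coe, Set.inter_comm]
  rw [h1, l1Radial, ← withDensity_smul _ hm]
  congr 1
  ext r
  rw [ENNReal.ofReal_mul (by positivity), ENNReal.ofReal_mul (by positivity), measureReal_def,
    ENNReal.ofReal_toReal (volume_l1Ball_lt_top d).ne]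
  simp

instance (d : ℕ) : SigmaFinite (l1Radial d) := by
  unfold l1Radial; exact SigmaFinite.withDensity_ofReal _

/-- Polar coordinates with respect to the `ℓ₁`-norm. -/
theorem map_smul_unifL1Sphere_prod_l1Radial {d : ℕ} (hd : 0 < d) :
    ((unifL1Sphere d).prod (l1Radial d)).map (fun p => p.2 • p.1) = volume := by
  have : Nonempty (Fin d) := ⟨⟨0, hd⟩⟩
  have : Nontrivial (PiLp 1 (fun _ : Fin d => ℝ)) := by
    have : Nontrivial (Fin d → ℝ) := inferInstance
    exact (WithLp.equiv 1 (Fin d → ℝ)).nontrivial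
  have hsm : Measurable (fun p : (Fin d → ℝ) × ℝ => p.2 • p.1) := by fun_prop
  have h1 : (unifL1Sphere d).prod (l1Radial d) =
      (l1Surface d).prod ((Measure.volumeIoiPow (d - 1)).map Subtype.val) := by
    rw [l1Surface_eq hd, l1Radial_eq, Measure.prod_smul_left, Measure.prod_smul_right]
  have h2 := (l1Volume d).measurePreserving_homeomorphUnitSphereProd
  have h3 : ((l1Volume d).toSphere.prod (Measure.volumeIoiPow (d - 1))).map
      (fun p => ((homeomorphUnitSphereProd _).symm p).1) = l1Volume d := by
    have h4 := h2.map_eq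
    rw [finrank_l1] at h4
    have hsymm : Measurable (fun p =>
        ((homeomorphUnitSphereProd (PiLp 1 (fun _ : Fin d => ℝ))).symm p).1) :=
      measurable_subtype_coe.comp (Homeomorph.measurable _)
    rw [← h4, Measure.map_map hsymm
      (Homeomorph.measurable _)]
    have : ((fun p => ((homeomorphUnitSphereProd (PiLp 1 (fun _ : Fin d => ℝ))).symm p).1) ∘
        homeomorphUnitSphereProd _) = Subtype.val := by
      funext x; simp only [Function.comp, Homeomorph.symm_apply_apply]
    rw [this, map_comap_subtype_coe (measurableSet_singleton _).compl,
      restrict_compl_singleton]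
  rw [h1, l1Surface, Measure.map_prod_map _ _ measurable_ofLp_sphere measurable_subtype_coe,
    Measure.map_map hsm (measurable_ofLp_sphere.prodMap measurable_subtype_coe),
    ← map_ofLp_l1Volume]
  conv_rhs => rw [← h3]
  have hsymm : Measurable (fun p =>
      ((homeomorphUnitSphereProd (PiLp 1 (fun _ : Fin d => ℝ))).symm p).1) :=
    measurable_subtype_coe.comp (Homeomorph.measurable _)
  rw [Measure.map_map measurable_ofLp_one hsymm]
  rfl

theorem ae_cond_l1Ball_coord_ne_zero (d : ℕ) :
    ∀ᵐ x ∂((volume : Measure (Fin d → ℝ))[|l1Ball d]), ∀ i, x i ≠ 0 := by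
  have h : ∀ᵐ x ∂(volume : Measure (Fin d → ℝ)), ∀ i, x i ≠ 0 := by
    rw [ae_all_iff]
    intro i
    rw [ae_iff]
    simpa [volume_pi] using Measure.pi_hyperplane (fun _ : Fin d => (volume : Measure ℝ)) i 0
  exact (cond_absolutelyContinuous (s := l1Ball d)).ae_le h

theorem l1norm_pos {d : ℕ} {x : Fin d → ℝ} (i : Fin d) (hx : x i ≠ 0) : 0 < l1norm x :=
  (abs_pos.2 hx).trans_le
    (Finset.single_le_sum (f := fun i => |x i|) (fun _ _ => abs_nonneg _) (Finset.mem_univ i))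

theorem ae_unifL1Sphere_coord_ne_zero (d : ℕ) : ∀ᵐ s ∂(unifL1Sphere d), ∀ i, s i ≠ 0 := by
  rw [unifL1Sphere_eq, ae_map_iff measurable_l1Normalize.aemeasurable]
  · filter_upwards [ae_cond_l1Ball_coord_ne_zero d] with x hx i
    have := (l1norm_pos i (hx i)).ne'
    simp [l1Normalize, hx i, this]
  · simp only [Set.ofPred_forall]
    exact MeasurableSet.iInter fun i => (measurable_pi_apply i) (measurableSet_singleton _).compl

theorem ae_unifL1Sphere_l1norm {d : ℕ} (hd : 0 < d) : ∀ᵐ s ∂(unifL1Sphere d), l1norm s = 1 := by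
  rw [unifL1Sphere_eq, ae_map_iff measurable_l1Normalize.aemeasurable]
  · filter_upwards [ae_cond_l1Ball_coord_ne_zero d] with x hx
    have := l1norm_pos ⟨0, hd⟩ (hx _)
    rw [l1Normalize, l1norm_smul, abs_of_pos (inv_pos.2 this), inv_mul_cancel₀ this.ne']
  · exact continuous_l1norm.measurable (measurableSet_singleton _)

theorem l1norm_mul_sign {d : ℕ} {ε : Fin d → ℝ} (hε : ∀ i, |ε i| = 1) (x : Fin d → ℝ) :
    l1norm (ε * x) = l1norm x := by
  simp [l1norm, abs_mul, hε]

/-- The uniform distribution on the `ℓ₁`-sphere is invariant under changes of signs. -/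
theorem measurePreserving_mul_sign {d : ℕ} {ε : Fin d → ℝ} (hε : ∀ i, |ε i| = 1) :
    MeasurePreserving (fun x => ε * x) (unifL1Sphere d) (unifL1Sphere d) := by
  have hm : Measurable (fun x : Fin d → ℝ => ε * x) := by fun_prop
  have h1 : MeasurePreserving (fun x : Fin d → ℝ => ε * x) volume volume := by
    refine volume_preserving_pi (f := fun i (t : ℝ) => ε i * t) fun i => ⟨by fun_prop, ?_⟩
    rw [Real.map_volume_mul_left (by intro h; simpa [h] using hε i), abs_inv, hε]
    simp
  have h2 : MeasurePreserving (fun x : Fin d → ℝ => ε * x) (volume[|l1Ball d])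
      (volume[|l1Ball d]) := by
    have hpre : (fun x : Fin d → ℝ => ε * x) ⁻¹' (l1Ball d) = l1Ball d := by
      ext x; simp [l1Ball, l1norm_mul_sign hε]
    have := (h1.restrict_preimage (measurableSet_l1Ball d)).smul_measure
      ((volume (l1Ball d))⁻¹)
    rwa [hpre] at this
  refine ⟨hm, ?_⟩
  rw [unifL1Sphere_eq, Measure.map_map hm measurable_l1Normalize]
  have : (fun x : Fin d → ℝ => ε * x) ∘ l1Normalize = l1Normalize ∘ (fun x => ε * x) := by
    funext x
    simp [l1Normalize, l1norm_mul_sign hε]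
  rw [this, ← Measure.map_map measurable_l1Normalize hm, h2.map_eq]

theorem measurePreserving_neg_unifL1Sphere (d : ℕ) :
    MeasurePreserving (fun x => -x) (unifL1Sphere d) (unifL1Sphere d) := by
  have := measurePreserving_mul_sign (d := d) (ε := fun _ => -1) (by simp)
  convert this using 2 with x
  ext i; simp

theorem integral_l1Radial (d : ℕ) (g : ℝ → ℝ) :
    ∫ r, g r ∂(l1Radial d) =
      d * volume.real (l1Ball d) * ∫ r in Set.Ioi (0 : ℝ), r ^ (d - 1) * g r := by
  rw [l1Radial, integral_withDensity_eq_integral_toReal_smul (by fun_prop) (by simp),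
    ← integral_const_mul]
  refine setIntegral_congr_fun measurableSet_Ioi fun r hr => ?_
  have hr : (0 : ℝ) < r := hr
  simp only [smul_eq_mul]
  rw [ENNReal.toReal_ofReal (by positivity), mul_assoc]

theorem integral_exp_neg_mul_pow (n : ℕ) :
    ∫ r in Set.Ioi (0 : ℝ), Real.exp (-r) * r ^ n = n.factorial := by
  rw [← Real.Gamma_nat_eq_factorial, Real.Gamma_eq_integral (by positivity)]
  refine setIntegral_congr_fun measurableSet_Ioi fun r hr => ?_
  simp [Real.rpow_natCast]

/-- Integration in polar coordinates against the Laplace weight `exp (-‖x‖₁)`. -/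
theorem integral_mul_exp_neg_l1norm {d : ℕ} (hd : 0 < d) (n : ℕ) (q : (Fin d → ℝ) → ℝ)
    (hq : Continuous q) (hom : ∀ r x, q (r • x) = r ^ n * q x) :
    ∫ x, q x * Real.exp (-l1norm x) =
      (∫ s, q s ∂(unifL1Sphere d)) *
        (d * volume.real (l1Ball d) * ((d - 1 + n).factorial : ℝ)) := by
  have hc : Continuous fun x : Fin d → ℝ => q x * Real.exp (-l1norm x) :=
    hq.mul (Real.continuous_exp.comp continuous_l1norm.neg)
  conv_lhs => rw [← map_smul_unifL1Sphere_prod_l1Radial hd,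
    integral_map (by fun_prop) hc.aestronglyMeasurable]
  have hae : ∀ᵐ p ∂((unifL1Sphere d).prod (l1Radial d)), l1norm p.1 = 1 ∧ 0 < p.2 := by
    have h1 : ∀ᵐ r ∂(l1Radial d), 0 < r :=
      (withDensity_absolutelyContinuous _ _).ae_le (ae_restrict_mem measurableSet_Ioi)
    have h2 := Measure.quasiMeasurePreserving_fst (μ := unifL1Sphere d) (ν := l1Radial d)
    have h3 := Measure.quasiMeasurePreserving_snd (μ := unifL1Sphere d) (ν := l1Radial d)
    exact (h2.ae (ae_unifL1Sphere_l1norm hd)).and (h3.ae h1)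
  have : ∫ p, q (p.2 • p.1) * Real.exp (-l1norm (p.2 • p.1)) ∂((unifL1Sphere d).prod (l1Radial d))
      = ∫ p, q p.1 * (Real.exp (-p.2) * p.2 ^ n) ∂((unifL1Sphere d).prod (l1Radial d)) := by
    refine integral_congr_ae ?_
    filter_upwards [hae] with p hp
    rw [hom, l1norm_smul, hp.1, abs_of_pos hp.2, mul_one]
    ring
  have hrad : ∀ r : ℝ, r ^ (d - 1) * (Real.exp (-r) * r ^ n) = Real.exp (-r) * r ^ (d - 1 + n) :=
    fun r => by rw [pow_add]; ring
  rw [this, integral_prod_mul q (fun r => Real.exp (-r) * r ^ n), integral_l1Radial,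
    ← integral_exp_neg_mul_pow]
  simp_rw [hrad]

theorem integral_abs_pow_mul_exp_neg_abs (n : ℕ) :
    ∫ x : ℝ, |x| ^ n * Real.exp (-|x|) = 2 * n.factorial := by
  rw [integral_comp_abs (f := fun r => r ^ n * Real.exp (-r)), ← integral_exp_neg_mul_pow]
  simp_rw [mul_comm]

theorem integral_abs_pow_coord_mul_exp_neg_l1norm {d : ℕ} (i : Fin d) (n : ℕ) :
    ∫ x : Fin d → ℝ, |x i| ^ n * Real.exp (-l1norm x) = n.factorial * 2 ^ d := by
  have h : ∀ x : Fin d → ℝ, |x i| ^ n * Real.exp (-l1norm x) =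
      ∏ j, (|x j| ^ (if j = i then n else 0) * Real.exp (-|x j|)) := by
    intro x
    rw [Finset.prod_mul_distrib, ← Real.exp_sum, Finset.sum_neg_distrib]
    congr 1
    rw [Finset.prod_eq_single i] <;> simp +contextual
  simp_rw [h]
  rw [integral_fintype_prod_volume_eq_prod
    (f := fun j (t : ℝ) => |t| ^ (if j = i then n else 0) * Real.exp (-|t|))]
  simp_rw [integral_abs_pow_mul_exp_neg_abs]
  rw [Finset.prod_mul_distrib, Finset.prod_eq_single (a := i) (f := fun j => (Nat.factorial _ : ℝ))]
  · simp [mul_comm]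
  · simp +contextual
  · simp

theorem integral_sq_coord_unifL1Sphere {d : ℕ} (i : Fin d) :
    ∫ s, (s i) ^ 2 ∂(unifL1Sphere d) = 2 / (d * (d + 1)) := by
  have hd : 0 < d := i.pos
  have h0 := integral_mul_exp_neg_l1norm hd 0 (fun _ => 1) continuous_const (by simp)
  have h2 := integral_mul_exp_neg_l1norm hd 2 (fun x => |x i| ^ 2) (by fun_prop)
    (by intro r x; simp [mul_pow])
  rw [integral_abs_pow_coord_mul_exp_neg_l1norm] at h2
  have h0' := integral_abs_pow_coord_mul_exp_neg_l1norm i 0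
  simp only [pow_zero] at h0'
  rw [h0'] at h0
  simp only [sq_abs] at h2
  obtain ⟨m, rfl⟩ : ∃ m, d = m + 1 := ⟨d - 1, by omega⟩
  have hV : 0 < volume.real (l1Ball (m + 1)) :=
    ENNReal.toReal_pos (volume_l1Ball_pos _).ne' (volume_l1Ball_lt_top _).ne
  simp only [integral_const, probReal_univ, smul_eq_mul, Nat.add_sub_cancel,
    Nat.factorial_succ, Nat.factorial_zero, add_zero] at h0 h2
  push_cast at h0 h2 ⊢
  have hf : (0 : ℝ) < (m.factorial : ℝ) := by positivity
  set V := volume.real (l1Ball (m + 1))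
  set I := ∫ s, (s i) ^ 2 ∂(unifL1Sphere (m + 1))
  have h3 : (1 + 1 : ℝ) * ((m + 1) * V * m.factorial) =
      I * ((m + 1) * V * ((m + 1 + 1) * ((m + 1) * m.factorial))) := by
    linear_combination h2 - 2 * h0
  rw [eq_div_iff (by positivity)]
  have h4 : ((m : ℝ) + 1) * V * m.factorial ≠ 0 := by positivity
  apply mul_left_cancel₀ h4
  linear_combination -h3

theorem abs_coord_le_l1norm {d : ℕ} (x : Fin d → ℝ) (i : Fin d) : |x i| ≤ l1norm x :=
  Finset.single_le_sum (f := fun i => |x i|) (fun _ _ => abs_nonneg _) (Finset.mem_univ i)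

theorem integrable_sq_coord_unifL1Sphere {d : ℕ} (i : Fin d) :
    Integrable (fun s => (s i) ^ 2) (unifL1Sphere d) := by
  have hc : Continuous fun s : Fin d → ℝ => s i ^ 2 := by fun_prop
  refine Integrable.of_bound hc.aestronglyMeasurable 1 ?_
  filter_upwards [ae_unifL1Sphere_l1norm i.pos] with s hs
  rw [Real.norm_eq_abs, abs_pow]
  exact pow_le_one₀ (abs_nonneg _) (hs ▸ abs_coord_le_l1norm s i)

theorem integral_sum_sq_unifL1Sphere {d : ℕ} (hd : 0 < d) :
    ∫ s, ∑ i, (s i) ^ 2 ∂(unifL1Sphere d) = 2 / (d + 1) := by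
  rw [integral_finsetSum _ fun i _ => integrable_sq_coord_unifL1Sphere i]
  simp only [integral_sq_coord_unifL1Sphere, Finset.sum_const, Finset.card_univ,
    Fintype.card_fin, nsmul_eq_mul]
  have : (d : ℝ) ≠ 0 := by positivity
  field_simp

/-! ### Second moment of symmetric differences -/

/-- The Efron–Stein (Poincaré) inequality on the discrete cube, for functions with bounded
differences `c i` in the coordinate directions. -/
theorem cube_variance_le {d : ℕ} (c : Fin d → ℝ) (F : (Fin d → Bool) → ℝ)
    (hF : ∀ i σ, |F (Function.update σ i true) - F (Function.update σ i false)| ≤ c i) :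
    2 ^ d * ∑ σ, F σ ^ 2 - (∑ σ, F σ) ^ 2 ≤ 4 ^ d / 4 * ∑ i, c i ^ 2 := by
  induction d with
  | zero => simp
  | succ d ih =>
    have hsum : ∀ H : (Fin (d + 1) → Bool) → ℝ, ∑ σ, H σ =
        ∑ τ : Fin d → Bool, H (Fin.cons true τ) + ∑ τ : Fin d → Bool, H (Fin.cons false τ) := by
      intro H
      rw [← (Fin.consEquiv (fun _ => Bool)).sum_comp, Fintype.sum_prod_type]
      simp [Fin.consEquiv]
    have key : ∀ b : Bool, 2 ^ d * ∑ τ : Fin d → Bool, F (Fin.cons b τ) ^ 2 -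
        (∑ τ : Fin d → Bool, F (Fin.cons b τ)) ^ 2 ≤ 4 ^ d / 4 * ∑ i : Fin d, c i.succ ^ 2 := by
      intro b
      refine ih (fun i => c i.succ) (fun τ => F (Fin.cons b τ)) fun i τ => ?_
      rw [Fin.cons_update, Fin.cons_update]
      exact hF i.succ _
    have hdiff : |∑ τ : Fin d → Bool, F (Fin.cons true τ) -
        ∑ τ : Fin d → Bool, F (Fin.cons false τ)| ≤ 2 ^ d * c 0 := by
      rw [← Finset.sum_sub_distrib]
      refine (Finset.abs_sum_le_sum_abs _ _).trans ?_
      have : ∀ τ : Fin d → Bool, |F (Fin.cons true τ) - F (Fin.cons false τ)| ≤ c 0 := by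
        intro τ
        simpa using hF 0 (Fin.cons true τ)
      refine (Finset.sum_le_sum fun τ _ => this τ).trans ?_
      simp
    rw [hsum, hsum, Fin.sum_univ_succ]
    have h1 := key true
    have h0 := key false
    have h2 : (∑ τ : Fin d → Bool, F (Fin.cons true τ) -
        ∑ τ : Fin d → Bool, F (Fin.cons false τ)) ^ 2 ≤ (2 ^ d * c 0) ^ 2 := by
      rw [← sq_abs]
      exact pow_le_pow_left₀ (abs_nonneg _) hdiff 2
    have h4 : ((2 : ℝ) ^ d) ^ 2 = 4 ^ d := by rw [← pow_mul, mul_comm, pow_mul]; norm_num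
    rw [mul_pow, h4] at h2
    rw [pow_succ (2 : ℝ), pow_succ (4 : ℝ)]
    linarith

/-- The sign `±1` encoded by a Boolean. -/
def boolSign (b : Bool) : ℝ := if b then 1 else -1

theorem abs_boolSign (b : Bool) : |boolSign b| = 1 := by cases b <;> simp [boolSign]

/-- Averaging over the signs of the coordinates: an odd combination of a function that is
`L`-Lipschitz for the `ℓ₁`-norm has mean square at most `4 L² ‖x‖₂²`. -/
theorem sum_sq_symmetric_difference_le {d : ℕ} {h : (Fin d → ℝ) → ℝ} {L : ℝ} {x : Fin d → ℝ}
    (hx : l1norm x ≤ 1)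
    (hL : ∀ a b, l1norm a ≤ 1 → l1norm b ≤ 1 → |h a - h b| ≤ L * l1norm (a - b)) :
    ∑ σ : Fin d → Bool, (h ((fun i => boolSign (σ i)) * x) -
      h (-((fun i => boolSign (σ i)) * x))) ^ 2 ≤ 2 ^ d * (4 * L ^ 2 * ∑ i, x i ^ 2) := by
  set e : (Fin d → Bool) → (Fin d → ℝ) := fun σ => (fun i => boolSign (σ i)) * x with he
  have hnorm : ∀ σ, l1norm (e σ) ≤ 1 := fun σ => by
    rw [he, l1norm_mul_sign fun i => abs_boolSign _]; exact hx
  have hnorm' : ∀ σ, l1norm (-e σ) ≤ 1 := fun σ => by rw [l1norm_neg]; exact hnorm σ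
  have hflip : ∀ i σ, l1norm (e (Function.update σ i true) - e (Function.update σ i false)) =
      2 * |x i| := by
    intro i σ
    unfold l1norm
    rw [Finset.sum_eq_single i]
    · simp only [he, Pi.sub_apply, Pi.mul_apply, Function.update_self, boolSign, if_true,
        Bool.false_eq_true, if_false]
      rw [show 1 * x i - -1 * x i = 2 * x i by ring, abs_mul, abs_two]
    · intro j _ hj
      simp [he, Function.update_of_ne hj]
    · simp
  have hodd : ∑ σ, (h (e σ) - h (-e σ)) = 0 := by
    rw [Finset.sum_sub_distrib, sub_eq_zero]
    have hneg : ∀ σ : Fin d → Bool, -e σ = e (fun i => !σ i) := by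
      intro σ
      ext i
      simp only [he, Pi.neg_apply, Pi.mul_apply]
      cases σ i <;> simp [boolSign]
    simp_rw [hneg]
    exact ((Equiv.piCongrRight fun _ : Fin d => Equiv.boolNot).sum_comp
      (fun σ => h (e σ))).symm
  have hv := cube_variance_le (fun i => 4 * L * |x i|) (fun σ => h (e σ) - h (-e σ)) (by
    intro i σ
    have h1 := hL _ _ (hnorm (Function.update σ i true)) (hnorm (Function.update σ i false))
    have h2 := hL _ _ (hnorm' (Function.update σ i true)) (hnorm' (Function.update σ i false))
    rw [show -e (Function.update σ i true) - -e (Function.update σ i false) =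
      -(e (Function.update σ i true) - e (Function.update σ i false)) by abel, l1norm_neg] at h2
    rw [hflip] at h1 h2
    rw [abs_le] at *
    constructor <;> linarith [h1.1, h1.2, h2.1, h2.2])
  rw [hodd] at hv
  have h4 : (4 : ℝ) ^ d = 2 ^ d * 2 ^ d := by rw [← mul_pow]; norm_num
  simp only [mul_pow, sq_abs, ← Finset.mul_sum, h4] at hv
  have h2 : (0 : ℝ) < 2 ^ d := by positivity
  refine le_of_mul_le_mul_left ?_ h2
  linarith

/-- On the `ℓ₁`-sphere, the symmetric difference of an `L`-Lipschitz function has mean square of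
order `L² / d`, a factor `d` below the trivial bound. -/
theorem integral_sq_symmetric_difference_le {d : ℕ} (hd : 0 < d) {h : (Fin d → ℝ) → ℝ} {L : ℝ}
    (hc : Continuous h)
    (hL : ∀ a b, l1norm a ≤ 1 → l1norm b ≤ 1 → |h a - h b| ≤ L * l1norm (a - b)) :
    ∫ s, (h s - h (-s)) ^ 2 ∂(unifL1Sphere d) ≤ 8 * L ^ 2 / (d + 1) := by
  set F : (Fin d → ℝ) → ℝ := fun s => (h s - h (-s)) ^ 2 with hF
  have hFc : Continuous F := by fun_prop
  have hFb : ∀ s, l1norm s ≤ 1 → ‖F s‖ ≤ (L * 2) ^ 2 := by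
    intro s hs
    have hL0 : 0 ≤ L * l1norm (s - -s) :=
      (abs_nonneg _).trans (hL s (-s) hs (by rwa [l1norm_neg]))
    have h1 := hL s (-s) hs (by rwa [l1norm_neg])
    have h2 : l1norm (s - -s) = 2 * l1norm s := by
      rw [show s - -s = (2 : ℝ) • s by rw [two_smul]; abel, l1norm_smul, abs_two]
    rw [Real.norm_eq_abs, hF, abs_pow]
    refine pow_le_pow_left₀ (abs_nonneg _) (h1.trans ?_) 2
    rw [h2] at hL0 ⊢
    rcases (l1norm_nonneg s).eq_or_lt with h0 | h0
    · rw [← h0]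
      have := hL (Pi.single ⟨0, hd⟩ 1) 0 (by simp [l1norm, Pi.single_apply, apply_ite abs])
        (by simp [l1norm])
      have h3 : l1norm ((Pi.single ⟨0, hd⟩ 1 : Fin d → ℝ) - 0) = 1 := by
        simp [l1norm, Pi.single_apply, apply_ite abs]
      rw [h3] at this
      linarith [(abs_nonneg _).trans this]
    · have : 0 ≤ L := by
        by_contra hneg
        push Not at hneg
        nlinarith
      nlinarith
  have hint : Integrable F (unifL1Sphere d) := by
    refine Integrable.of_bound hFc.aestronglyMeasurable ((L * 2) ^ 2) ?_
    filter_upwards [ae_unifL1Sphere_l1norm hd] with s hs using hFb s hs.le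
  have hmp : ∀ σ : Fin d → Bool, MeasurePreserving (fun x => (fun i => boolSign (σ i)) * x)
      (unifL1Sphere d) (unifL1Sphere d) :=
    fun σ => measurePreserving_mul_sign fun i => abs_boolSign _
  have hσ : ∀ σ : Fin d → Bool,
      ∫ s, F ((fun i => boolSign (σ i)) * s) ∂(unifL1Sphere d) = ∫ s, F s ∂(unifL1Sphere d) := by
    intro σ
    rw [← integral_map (hmp σ).measurable.aemeasurable (by fun_prop), (hmp σ).map_eq]
  -- by invariance, the mean of `F` is the mean of its average over all changes of signs
  have havg : 2 ^ d * ∫ s, F s ∂(unifL1Sphere d) =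
      ∫ s, ∑ σ : Fin d → Bool, F ((fun i => boolSign (σ i)) * s) ∂(unifL1Sphere d) := by
    rw [integral_finsetSum]
    · simp [hσ]
    · exact fun σ _ => (hmp σ).integrable_comp_of_integrable hint
  have hle : ∫ s, ∑ σ : Fin d → Bool, F ((fun i => boolSign (σ i)) * s) ∂(unifL1Sphere d) ≤
      ∫ s, 2 ^ d * (4 * L ^ 2 * ∑ i, s i ^ 2) ∂(unifL1Sphere d) := by
    refine integral_mono_ae ?_ ?_ ?_
    · exact integrable_finsetSum _ fun σ _ => (hmp σ).integrable_comp_of_integrable hint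
    · exact ((integrable_finsetSum _ fun i _ =>
        integrable_sq_coord_unifL1Sphere i).const_mul _).const_mul _
    · filter_upwards [ae_unifL1Sphere_l1norm hd] with s hs
      exact sum_sq_symmetric_difference_le hs.le hL
  rw [← havg, integral_const_mul, integral_const_mul, integral_sum_sq_unifL1Sphere hd] at hle
  have h2 : (0 : ℝ) < 2 ^ d := by positivity
  have := le_of_mul_le_mul_left hle h2
  refine this.trans (le_of_eq ?_)
  ring

/-! ### The two-point gradient estimator -/

theorem measurable_signVec_dotProduct {d : ℕ} (w : Fin d → ℝ) :
    Measurable fun x : Fin d → ℝ => signVec x ⬝ᵥ w := by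
  unfold dotProduct
  exact Finset.measurable_fun_sum _ fun i _ =>
    ((measurable_pi_apply i).comp measurable_signVec).mul_const _

/-- The mass of a function in a sublevel set `{‖x‖₁ + δ ⟨signVec x, w⟩ < 1}`, which is star-shaped
with radius `1 - δ ⟨signVec s, w⟩` in the direction `s`, in polar coordinates. -/
theorem setIntegral_starshaped {d : ℕ} (hd : 0 < d) {h : (Fin d → ℝ) → ℝ} (hc : Continuous h)
    (w : Fin d → ℝ) {δ : ℝ} (hδ : ∀ s : Fin d → ℝ, δ * (signVec s ⬝ᵥ w) ≤ 1)
    (hint : IntegrableOn h {x | l1norm x + δ * (signVec x ⬝ᵥ w) < 1}) :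
    Integrable (fun s => d * volume.real (l1Ball d) *
        (∫ r in (0 : ℝ)..(1 - δ * (signVec s ⬝ᵥ w)), r ^ (d - 1) * h (r • s))) (unifL1Sphere d) ∧
    ∫ x in {x | l1norm x + δ * (signVec x ⬝ᵥ w) < 1}, h x =
      ∫ s, d * volume.real (l1Ball d) *
        (∫ r in (0 : ℝ)..(1 - δ * (signVec s ⬝ᵥ w)), r ^ (d - 1) * h (r • s))
        ∂(unifL1Sphere d) := by
  set S : Set (Fin d → ℝ) := {x | l1norm x + δ * (signVec x ⬝ᵥ w) < 1} with hS
  have hdot := measurable_signVec_dotProduct w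
  have hSm : MeasurableSet S :=
    measurableSet_lt (continuous_l1norm.measurable.add (hdot.const_mul _)) measurable_const
  have hsm : Measurable (fun p : (Fin d → ℝ) × ℝ => p.2 • p.1) := by fun_prop
  have hFm : AEStronglyMeasurable (S.indicator h)
      (((unifL1Sphere d).prod (l1Radial d)).map (fun p => p.2 • p.1)) :=
    (hc.measurable.indicator hSm).aestronglyMeasurable
  rw [← integral_indicator hSm]
  have hint' : Integrable (fun p : (Fin d → ℝ) × ℝ => S.indicator h (p.2 • p.1))
      ((unifL1Sphere d).prod (l1Radial d)) := by
    have := (integrable_indicator_iff hSm).2 hint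
    rw [← map_smul_unifL1Sphere_prod_l1Radial hd] at this
    exact this.comp_measurable hsm
  suffices hae : (fun s => ∫ r, S.indicator h (r • s) ∂(l1Radial d)) =ᵐ[unifL1Sphere d]
      fun s => d * volume.real (l1Ball d) *
        (∫ r in (0 : ℝ)..(1 - δ * (signVec s ⬝ᵥ w)), r ^ (d - 1) * h (r • s)) by
    refine ⟨hint'.integral_prod_left.congr hae, ?_⟩
    conv_lhs => rw [← map_smul_unifL1Sphere_prod_l1Radial hd, integral_map hsm.aemeasurable hFm,
      integral_prod _ hint']
    exact integral_congr_ae hae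
  filter_upwards [ae_unifL1Sphere_l1norm hd] with s hs
  rw [integral_l1Radial]
  congr 1
  rw [intervalIntegral.integral_of_le (by linarith [hδ s]), ← integral_indicator measurableSet_Ioi,
    integral_Ioc_eq_integral_Ioo, ← integral_indicator measurableSet_Ioo]
  congr 1
  ext r
  by_cases hr : 0 < r
  · have hmem : r • s ∈ S ↔ r < 1 - δ * (signVec s ⬝ᵥ w) := by
      rw [hS, Set.mem_ofPred_eq, signVec_smul_of_pos hr, l1norm_smul, hs, abs_of_pos hr]
      constructor <;> intro h <;> linarith
    by_cases h2 : r < 1 - δ * (signVec s ⬝ᵥ w)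
    · simp [hr, h2, hmem.2 h2]
    · simp [hr, h2, mt hmem.1 h2]
  · simp [hr]

/-- The derivative at `δ = 0` of the radial integral over a shell of thickness `δ c`. -/
theorem tendsto_slope_radial_integral {d : ℕ} {h : (Fin d → ℝ) → ℝ} (hc : Continuous h)
    (s : Fin d → ℝ) (c : ℝ) :
    Filter.Tendsto (fun δ : ℝ => δ⁻¹ * ∫ r in (1 - δ * c)..1, r ^ (d - 1) * h (r • s))
      (𝓝[>] 0) (𝓝 (c * h s)) := by
  have hk : Continuous fun r : ℝ => r ^ (d - 1) * h (r • s) := by fun_prop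
  have h1 : HasDerivAt (fun a : ℝ => ∫ r in a..1, r ^ (d - 1) * h (r • s)) (-h s) (1 - 0 * c) := by
    have := intervalIntegral.integral_hasDerivAt_left (hk.intervalIntegrable (1 - 0 * c) 1)
      (hk.stronglyMeasurableAtFilter _ _) hk.continuousAt
    simpa using this
  have h2 : HasDerivAt (fun δ : ℝ => 1 - δ * c) (-c) 0 := by
    simpa using ((hasDerivAt_id (0 : ℝ)).mul_const c).const_sub 1
  have h3 := (h1.comp (0 : ℝ) h2).tendsto_slope_zero_right
  simpa [mul_comm] using h3

/-- The integrals over the shells between `B` and the star-shaped sets, divided by `δ`, converge to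
an integral over the sphere. -/
theorem integral_radial_difference_limit {d : ℕ} (hd : 0 < d) {h : (Fin d → ℝ) → ℝ}
    (hc : Continuous h) {w : Fin d → ℝ} (hw : l1norm w ≤ 2) :
    Filter.Tendsto (fun δ : ℝ => ∫ s, δ⁻¹ *
        (∫ r in (1 - δ * (signVec s ⬝ᵥ w))..1, r ^ (d - 1) * h (r • s)) ∂(unifL1Sphere d))
      (𝓝[>] 0) (𝓝 (∫ s, (signVec s ⬝ᵥ w) * h s ∂(unifL1Sphere d))) := by
  have hdot := measurable_signVec_dotProduct w
  have hσ : ∀ s : Fin d → ℝ, |signVec s ⬝ᵥ w| ≤ 2 := fun s =>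
    (abs_dotProduct_le _ _).trans
      ((mul_le_of_le_one_left (l1norm_nonneg _) (norm_signVec_le s)).trans hw)
  have hkc : Continuous fun p : (Fin d → ℝ) × ℝ => p.2 ^ (d - 1) * h (p.2 • p.1) := by fun_prop
  obtain ⟨M, hM⟩ : ∃ M, ∀ s r, l1norm s = 1 → r ∈ Set.Icc (-1 : ℝ) 3 →
      ‖r ^ (d - 1) * h (r • s)‖ ≤ M := by
    have hK : IsCompact ((Set.Icc (fun _ => -1) (fun _ => 1) : Set (Fin d → ℝ)) ×ˢ
        Set.Icc (-1 : ℝ) 3) := isCompact_Icc.prod isCompact_Icc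
    obtain ⟨M, hM⟩ := hK.exists_bound_of_continuousOn hkc.continuousOn
    refine ⟨M, fun s r hs hr => hM (s, r) ⟨?_, hr⟩⟩
    have : ∀ i, |s i| ≤ 1 := fun i => hs ▸ abs_coord_le_l1norm s i
    exact ⟨fun i => (abs_le.1 (this i)).1, fun i => (abs_le.1 (this i)).2⟩
  refine tendsto_integral_filter_of_dominated_convergence (fun _ => M * 2) ?_ ?_
    (integrable_const _) (.of_forall fun s => tendsto_slope_radial_integral hc s _)
  · refine .of_forall fun δ => ?_
    have hcont : Continuous fun p : (Fin d → ℝ) × ℝ =>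
        ∫ r in (1 : ℝ)..p.2, r ^ (d - 1) * h (r • p.1) :=
      intervalIntegral.continuous_parametric_intervalIntegral_of_continuous (by fun_prop)
        continuous_snd
    have : Measurable fun s : Fin d → ℝ => (s, 1 - δ * (signVec s ⬝ᵥ w)) :=
      measurable_id.prodMk ((hdot.const_mul _).const_sub _)
    have h2 := (hcont.measurable.comp this).neg.const_mul δ⁻¹
    refine h2.aestronglyMeasurable.congr (.of_forall fun s => ?_)
    simp [intervalIntegral.integral_symm 1]
  · have hlt : ∀ᶠ δ : ℝ in 𝓝[>] 0, δ < 1 := nhdsWithin_le_nhds (eventually_lt_nhds one_pos)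
    filter_upwards [hlt, self_mem_nhdsWithin] with δ hδ1 hδ0
    have hδ0 : 0 < δ := hδ0
    filter_upwards [ae_unifL1Sphere_l1norm hd] with s hs
    have h1 : |δ * (signVec s ⬝ᵥ w)| ≤ δ * 2 := by
      rw [abs_mul, abs_of_pos hδ0]; exact mul_le_mul_of_nonneg_left (hσ s) hδ0.le
    have h2 := abs_le.1 h1
    have h3 : ‖∫ r in (1 - δ * (signVec s ⬝ᵥ w))..1, r ^ (d - 1) * h (r • s)‖ ≤
        M * |1 - (1 - δ * (signVec s ⬝ᵥ w))| := by
      refine intervalIntegral.norm_integral_le_of_norm_le_const fun r hr => hM s r hs ?_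
      rcases Set.mem_uIoc.1 hr with h | h <;> constructor <;> linarith [h.1, h.2, h2.1, h2.2]
    have hM0 : 0 ≤ M := (norm_nonneg _).trans (hM s 1 hs (by norm_num))
    rw [norm_mul, norm_inv, Real.norm_eq_abs δ, abs_of_pos hδ0, inv_mul_le_iff₀ hδ0]
    refine h3.trans ?_
    rw [sub_sub_cancel]
    nlinarith

theorem isBounded_l1norm_le {d : ℕ} (R : ℝ) :
    Bornology.IsBounded {x : Fin d → ℝ | l1norm x ≤ R} := by
  refine Metric.isBounded_Icc (fun _ => -R) (fun _ => R) |>.subset fun x hx => ?_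
  have : ∀ i, |x i| ≤ R := fun i => (abs_coord_le_l1norm x i).trans hx
  exact ⟨fun i => (abs_le.1 (this i)).1, fun i => (abs_le.1 (this i)).2⟩

theorem isCompact_l1norm_le {d : ℕ} (R : ℝ) : IsCompact {x : Fin d → ℝ | l1norm x ≤ R} :=
  Metric.isCompact_of_isClosed_isBounded (isClosed_le continuous_l1norm continuous_const)
    (isBounded_l1norm_le R)

theorem l1norm_simplex {d : ℕ} {x : Fin d → ℝ} (hx : x ∈ stdSimplex ℝ (Fin d)) : l1norm x = 1 := by
  rw [← hx.2]
  exact Finset.sum_congr rfl fun i _ => abs_of_nonneg (hx.1 i)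

theorem l1norm_sub_simplex_le {d : ℕ} {x y : Fin d → ℝ} (hx : x ∈ stdSimplex ℝ (Fin d))
    (hy : y ∈ stdSimplex ℝ (Fin d)) : l1norm (x - y) ≤ 2 := by
  refine (l1norm_sub_le x y).trans ?_
  rw [l1norm_simplex hx, l1norm_simplex hy]; norm_num

theorem add_smul_mem_simplexNhd {d : ℕ} {μ : ℝ} (hμ : 0 ≤ μ) {y : Fin d → ℝ}
    (hy : y ∈ stdSimplex ℝ (Fin d)) {x : Fin d → ℝ} (hx : l1norm x ≤ 1) :
    y + μ • x ∈ simplexNhd d μ := by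
  refine ⟨y, hy, ?_⟩
  rw [add_sub_cancel_left, l1norm_smul, abs_of_nonneg hμ]
  exact mul_le_of_le_one_right hμ hx

/-- Convexity makes the difference quotient of `f` at `y + μ x`, in the direction from `v` to `y`,
at least `f y - f v` up to the smoothing error. -/
theorem convex_difference_le {d : ℕ} {f : (Fin d → ℝ) → ℝ} (hf : ConvexOn ℝ Set.univ f)
    {μ G : ℝ} (hμ : 0 < μ) (hG : 0 ≤ G)
    (hL : ∀ x ∈ simplexNhd d μ, ∀ y ∈ simplexNhd d μ, |f x - f y| ≤ G * l1norm (x - y))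
    {y v x : Fin d → ℝ} (hy : y ∈ stdSimplex ℝ (Fin d)) (hv : v ∈ stdSimplex ℝ (Fin d))
    (hx : l1norm x ≤ 1) {ε : ℝ} (hε0 : 0 ≤ ε) (hε1 : ε ≤ 1) :
    ε * (f y - f v - 2 * (G * μ)) ≤ f (y + μ • x) - f (y + μ • x - ε • (y - v)) := by
  have hclose : ∀ z ∈ stdSimplex ℝ (Fin d), |f (z + μ • x) - f z| ≤ G * μ := by
    intro z hz
    refine (hL _ (add_smul_mem_simplexNhd hμ.le hz hx) z
      (by simpa using add_smul_mem_simplexNhd hμ.le hz (x := 0) (by simp [l1norm]))).trans ?_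
    rw [add_sub_cancel_left, l1norm_smul, abs_of_pos hμ]
    exact mul_le_mul_of_nonneg_left (mul_le_of_le_one_right hμ.le hx) hG
  have h1 := abs_le.1 (hclose y hy)
  have h2 := abs_le.1 (hclose v hv)
  have h3 := hf.2 (Set.mem_univ (y + μ • x)) (Set.mem_univ (v + μ • x)) (sub_nonneg.2 hε1) hε0
    (by ring)
  have h4 : (1 - ε) • (y + μ • x) + ε • (v + μ • x) = y + μ • x - ε • (y - v) := by
    module
  rw [h4, smul_eq_mul, smul_eq_mul] at h3
  nlinarith

/-- The mean of the gradient estimator, for a function that is nonpositive near `y`. The shifted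
ball `B - δ w` lies in the star-shaped set `{‖x‖₁ + δ ⟨signVec x, w⟩ < 1}`, and polar coordinates
turn the difference of the integrals over `B` and over this set into an integral over the
sphere. -/
theorem sub_le_integral_signVec_of_nonpos {d : ℕ} (hd : 0 < d) {f : (Fin d → ℝ) → ℝ}
    (hf : ConvexOn ℝ Set.univ f) {μ G : ℝ} (hμ : 0 < μ) (hG : 0 ≤ G)
    (hL : ∀ x ∈ simplexNhd d μ, ∀ y ∈ simplexNhd d μ, |f x - f y| ≤ G * l1norm (x - y))
    {y v : Fin d → ℝ} (hy : y ∈ stdSimplex ℝ (Fin d)) (hv : v ∈ stdSimplex ℝ (Fin d))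
    (hneg : ∀ x, l1norm x ≤ 3 → f (y + μ • x) ≤ 0) :
    f y - f v - 2 * (G * μ) ≤
      d / μ * ∫ s, (signVec s ⬝ᵥ (y - v)) * f (y + μ • s) ∂(unifL1Sphere d) := by
  set w := y - v with hw
  set h : (Fin d → ℝ) → ℝ := fun x => f (y + μ • x) with hh
  set c := f y - f v - 2 * (G * μ) with hcdef
  set V := volume.real (l1Ball d) with hV
  have hVpos : 0 < V := ENNReal.toReal_pos (volume_l1Ball_pos d).ne' (volume_l1Ball_lt_top d).ne
  have hfc : Continuous f := continuousOn_univ.1 (hf.continuousOn isOpen_univ)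
  have hc : Continuous h := by fun_prop
  have hw2 : l1norm w ≤ 2 := l1norm_sub_simplex_le hy hv
  have hσ : ∀ s : Fin d → ℝ, |signVec s ⬝ᵥ w| ≤ 2 := fun s =>
    (abs_dotProduct_le _ _).trans
      ((mul_le_of_le_one_left (l1norm_nonneg _) (norm_signVec_le s)).trans hw2)
  have hlim := (integral_radial_difference_limit hd hc hw2).const_mul (d / μ)
  refine ge_of_tendsto hlim ?_
  have hlt : ∀ᶠ δ : ℝ in 𝓝[>] 0, δ < min (1 / 2) (1 / μ) :=
    nhdsWithin_le_nhds (eventually_lt_nhds (by positivity))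
  filter_upwards [hlt, self_mem_nhdsWithin] with δ hδ1 hδ0
  have hδ0 : 0 < δ := hδ0
  have hδ2 : δ ≤ 1 / 2 := (hδ1.trans_le (min_le_left _ _)).le
  have hδμ : δ * μ ≤ 1 := by
    have := (hδ1.trans_le (min_le_right _ _)).le
    rwa [le_div_iff₀ hμ] at this
  have hδσ : ∀ s : Fin d → ℝ, |δ * (signVec s ⬝ᵥ w)| ≤ 1 := fun s => by
    rw [abs_mul, abs_of_pos hδ0]; nlinarith [hσ s, abs_nonneg (signVec s ⬝ᵥ w)]
  have hintR : ∀ S : Set (Fin d → ℝ), S ⊆ {x | l1norm x ≤ 3} → IntegrableOn h S := fun S hS =>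
    (hc.continuousOn.integrableOn_compact (isCompact_l1norm_le 3)).mono_set hS
  set S : Set (Fin d → ℝ) := {x | l1norm x + δ * (signVec x ⬝ᵥ w) < 1} with hSdef
  have hSsub : S ⊆ {x | l1norm x ≤ 3} := fun x hx => by
    have hx : l1norm x + δ * (signVec x ⬝ᵥ w) < 1 := hx
    have := (abs_le.1 (hδσ x)).1
    show l1norm x ≤ 3
    linarith
  have hBsub : l1Ball d ⊆ {x | l1norm x ≤ 3} := fun x hx => by
    have hx : l1norm x < 1 := hx
    show l1norm x ≤ 3
    linarith
  set B' : Set (Fin d → ℝ) := {x | l1norm (x + δ • w) < 1} with hB'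
  -- `signVec x` is a subgradient of the norm at `x`
  have hB'S : B' ⊆ S := fun x hx => by
    have h1 := l1norm_add_signVec_le x (δ • w)
    rw [dotProduct_smul, smul_eq_mul] at h1
    exact h1.trans_lt hx
  have hSm : MeasurableSet S :=
    measurableSet_lt (continuous_l1norm.measurable.add
      ((measurable_signVec_dotProduct w).const_mul _)) measurable_const
  have hB'm : MeasurableSet B' :=
    (isOpen_lt (continuous_l1norm.comp (by fun_prop)) continuous_const).measurableSet
  have hshift : ∫ x in l1Ball d, h (x - δ • w) = ∫ x in B', h x := by
    rw [← integral_indicator (measurableSet_l1Ball d), ← integral_indicator hB'm,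
      ← integral_add_right_eq_self _ (δ • w)]
    congr 1
    ext x
    simp [Set.indicator, l1Ball, hB']
  -- enlarging the domain decreases the integral, as `h` is nonpositive there
  have hmono : ∫ x in S, h x ≤ ∫ x in B', h x := by
    have h1 : 0 ≤ ∫ x in S \ B', -h x :=
      setIntegral_nonneg (hSm.diff hB'm) fun x hx => neg_nonneg.2 (hneg x (hSsub hx.1))
    have h2 := setIntegral_sdiff hB'm (hintR S hSsub) hB'S
    rw [integral_neg, h2] at h1
    linarith
  -- integrate the convexity inequality over the ball, with step `ε = δ μ`
  have hconv : δ * μ * c * V ≤ ∫ x in l1Ball d, (h x - h (x - δ • w)) := by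
    have h1 : ∫ x in l1Ball d, δ * μ * c = δ * μ * c * V := by
      rw [setIntegral_const, smul_eq_mul, mul_comm]
    rw [← h1]
    refine setIntegral_mono_on ?_ ?_ (measurableSet_l1Ball d) fun x hx => ?_
    · exact integrableOn_const (volume_l1Ball_lt_top d).ne
    · have : Continuous fun x => h x - h (x - δ • w) := by fun_prop
      exact (this.continuousOn.integrableOn_compact (isCompact_l1norm_le 3)).mono_set hBsub
    · have hx : l1norm x < 1 := hx
      have := convex_difference_le hf hμ hG hL hy hv hx.le (ε := δ * μ) (by positivity) hδμ
      refine this.trans (le_of_eq ?_)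
      simp only [hh]
      congr 2
      module
  have hsub : ∫ x in l1Ball d, (h x - h (x - δ • w)) =
      (∫ x in l1Ball d, h x) - ∫ x in B', h x := by
    rw [integral_sub (hintR _ hBsub), hshift]
    have : Continuous fun x => h (x - δ • w) := by fun_prop
    exact (this.continuousOn.integrableOn_compact (isCompact_l1norm_le 3)).mono_set hBsub
  obtain ⟨i1, e1⟩ := setIntegral_starshaped hd hc w (fun s => (abs_le.1 (hδσ s)).2)
    (hintR S hSsub)
  obtain ⟨i0, e0⟩ := setIntegral_starshaped hd hc w (δ := 0) (by simp)
    (by simpa [l1Ball] using hintR _ hBsub)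
  have hB0 : {x : Fin d → ℝ | l1norm x + 0 * (signVec x ⬝ᵥ w) < 1} = l1Ball d := by
    simp [l1Ball]
  rw [hB0] at e0
  have hkc : ∀ s : Fin d → ℝ, Continuous fun r : ℝ => r ^ (d - 1) * h (r • s) := by
    intro s; fun_prop
  have hdiff : (∫ x in l1Ball d, h x) - ∫ x in S, h x = d * V * ∫ s,
      (∫ r in (1 - δ * (signVec s ⬝ᵥ w))..1, r ^ (d - 1) * h (r • s)) ∂(unifL1Sphere d) := by
    rw [e0, e1, ← integral_sub i0 i1, ← integral_const_mul]
    refine integral_congr_ae (.of_forall fun s => ?_)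
    simp only [zero_mul, sub_zero]
    rw [← mul_sub, intervalIntegral.integral_interval_sub_left
      ((hkc s).intervalIntegrable _ _) ((hkc s).intervalIntegrable _ _)]
  rw [integral_const_mul]
  set J := ∫ s, (∫ r in (1 - δ * (signVec s ⬝ᵥ w))..1, r ^ (d - 1) * h (r • s)) ∂(unifL1Sphere d)
  have hfin : δ * μ * c * V ≤ d * V * J := by linarith
  have h5 : c * (δ * μ * V) ≤ (d / μ * (δ⁻¹ * J)) * (δ * μ * V) := by
    calc c * (δ * μ * V) = δ * μ * c * V := by ring
      _ ≤ d * V * J := hfin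
      _ = _ := by field_simp
  exact le_of_mul_le_mul_right h5 (by positivity)

/-- The two-point estimator of a convex function, tested against `y - v`, has mean at least
`f y - f v` up to the smoothing error: it is a subgradient of the average of `f` over
`ℓ₁`-balls. -/
theorem sub_le_integral_estimator {d : ℕ} (hd : 0 < d) {f : (Fin d → ℝ) → ℝ}
    (hf : ConvexOn ℝ Set.univ f) {μ G : ℝ} (hμ : 0 < μ) (hG : 0 ≤ G)
    (hL : ∀ x ∈ simplexNhd d μ, ∀ y ∈ simplexNhd d μ, |f x - f y| ≤ G * l1norm (x - y))
    {y v : Fin d → ℝ} (hy : y ∈ stdSimplex ℝ (Fin d)) (hv : v ∈ stdSimplex ℝ (Fin d)) :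
    f y - f v - 2 * (G * μ) ≤
      ∫ s, ((d / (2 * μ) * (f (y + μ • s) - f (y - μ • s))) • signVec s) ⬝ᵥ (y - v)
        ∂(unifL1Sphere d) := by
  have hfc : Continuous f := continuousOn_univ.1 (hf.continuousOn isOpen_univ)
  have hcy : Continuous fun x => f (y + μ • x) := by fun_prop
  obtain ⟨M, hM⟩ := (isCompact_l1norm_le (d := d) 3).exists_bound_of_continuousOn hcy.continuousOn
  -- subtracting a constant changes neither the differences of `f` nor the estimator
  have hf' : ConvexOn ℝ Set.univ (fun x => f x - M) := by
    exact hf.add_const (-M)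
  have key := sub_le_integral_signVec_of_nonpos hd hf' hμ hG
    (fun a ha b hb => by simpa using hL a ha b hb) hy hv
    (fun x hx => by have := (abs_le.1 (hM x hx)).2; linarith)
  set h : (Fin d → ℝ) → ℝ := fun x => f (y + μ • x) - M with hh
  have hc : Continuous h := by fun_prop
  have hint : Integrable (fun s => (signVec s ⬝ᵥ (y - v)) * h s) (unifL1Sphere d) := by
    obtain ⟨K, hK⟩ := (isCompact_l1norm_le (d := d) 1).exists_bound_of_continuousOn hc.continuousOn
    refine Integrable.of_bound
      ((measurable_signVec_dotProduct _).mul hc.measurable).aestronglyMeasurable (2 * K) ?_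
    filter_upwards [ae_unifL1Sphere_l1norm hd] with s hs
    rw [norm_mul]
    refine mul_le_mul ?_ (hK s hs.le) (norm_nonneg _) zero_le_two
    exact (abs_dotProduct_le _ _).trans ((mul_le_of_le_one_left (l1norm_nonneg _)
      (norm_signVec_le s)).trans (l1norm_sub_simplex_le hy hv))
  have hmp := measurePreserving_neg_unifL1Sphere d
  have hsymm : ∫ s, (signVec s ⬝ᵥ (y - v)) * h (-s) ∂(unifL1Sphere d) =
      -∫ s, (signVec s ⬝ᵥ (y - v)) * h s ∂(unifL1Sphere d) := by
    have h1 : ∫ s, (signVec (-s) ⬝ᵥ (y - v)) * h (- -s) ∂(unifL1Sphere d) =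
        ∫ s, (signVec s ⬝ᵥ (y - v)) * h (-s) ∂(unifL1Sphere d) := by
      rw [← integral_map (φ := fun s => -s) (f := fun s => (signVec s ⬝ᵥ (y - v)) * h (-s))
        hmp.measurable.aemeasurable, hmp.map_eq]
      exact ((measurable_signVec_dotProduct _).mul
        (hc.measurable.comp measurable_neg)).aestronglyMeasurable
    rw [← h1, ← integral_neg]
    refine integral_congr_ae ?_
    filter_upwards [ae_unifL1Sphere_coord_ne_zero d] with s hs
    rw [signVec_neg hs, neg_dotProduct, neg_neg, neg_mul]
  have hint' : Integrable (fun s => (signVec s ⬝ᵥ (y - v)) * h (-s)) (unifL1Sphere d) := by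
    refine (hmp.integrable_comp_of_integrable hint).neg.congr ?_
    filter_upwards [ae_unifL1Sphere_coord_ne_zero d] with s hs
    simp only [Function.comp, Pi.neg_apply]
    rw [signVec_neg hs, neg_dotProduct, neg_mul, neg_neg]
  have heq : ∀ s, ((d / (2 * μ) * (f (y + μ • s) - f (y - μ • s))) • signVec s) ⬝ᵥ (y - v) =
      d / (2 * μ) * ((signVec s ⬝ᵥ (y - v)) * h s - (signVec s ⬝ᵥ (y - v)) * h (-s)) := by
    intro s
    rw [smul_dotProduct, smul_eq_mul, hh]
    simp only [smul_neg, ← sub_eq_add_neg]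
    ring
  simp_rw [heq]
  rw [integral_const_mul, integral_sub hint hint', hsymm]
  set J := ∫ s, (signVec s ⬝ᵥ (y - v)) * h s ∂(unifL1Sphere d)
  have key' : f y - M - (f v - M) - 2 * (G * μ) ≤ d / μ * J := key
  have hJ : d / (2 * μ) * (J - -J) = d / μ * J := by field_simp; ring
  rw [hJ]
  linarith

/-! ### The negative entropy and its Bregman divergence -/

theorem continuous_negEntropy {d : ℕ} : Continuous (negEntropy (d := d)) := by
  unfold negEntropy
  exact continuous_finsetSum _ fun i _ => Real.continuous_mul_log.comp (continuous_apply i)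

theorem hasFDerivAt_negEntropy {d : ℕ} {x : Fin d → ℝ} (hx : ∀ i, 0 < x i) :
    HasFDerivAt negEntropy
      (∑ j, (Real.log (x j) + 1) • (ContinuousLinearMap.proj j : (Fin d → ℝ) →L[ℝ] ℝ)) x := by
  unfold negEntropy
  refine HasFDerivAt.fun_sum fun j _ => ?_
  exact (Real.hasDerivAt_mul_log (hx j).ne').comp_hasFDerivAt x
    (ContinuousLinearMap.proj (R := ℝ) (φ := fun _ : Fin d => ℝ) j).hasFDerivAt

theorem gradVec_negEntropy {d : ℕ} {x : Fin d → ℝ} (hx : ∀ i, 0 < x i) :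
    gradVec negEntropy x = fun j => Real.log (x j) + 1 := by
  ext j
  rw [gradVec, (hasFDerivAt_negEntropy hx).fderiv]
  simp [Pi.single_apply]

theorem hasFDerivAt_negEntropy_apply {d : ℕ} {x : Fin d → ℝ} (hx : ∀ i, 0 < x i) (v : Fin d → ℝ) :
    (∑ j, (Real.log (x j) + 1) • (ContinuousLinearMap.proj j : (Fin d → ℝ) →L[ℝ] ℝ)) v =
      gradVec negEntropy x ⬝ᵥ v := by
  simp [gradVec_negEntropy hx, dotProduct]

theorem bregman_negEntropy {d : ℕ} (z : Fin d → ℝ) {y : Fin d → ℝ} (hy : ∀ i, 0 < y i) :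
    bregman negEntropy z y =
      ∑ i, (z i * Real.log (z i) - z i * Real.log (y i) - z i + y i) := by
  rw [bregman, gradVec_negEntropy hy, negEntropy, negEntropy, dotProduct,
    ← Finset.sum_sub_distrib, ← Finset.sum_sub_distrib]
  refine Finset.sum_congr rfl fun i _ => ?_
  simp only [Pi.sub_apply]
  ring

/-- The summands of the relative entropy dominate those of the squared Hellinger distance. -/
theorem sq_sqrt_sub_sqrt_le {z y : ℝ} (hz : 0 ≤ z) (hy : 0 < y) :
    (√z - √y) ^ 2 ≤ z * Real.log z - z * Real.log y - z + y := by
  rcases hz.eq_or_lt with rfl | hz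
  · simp [Real.sq_sqrt hy.le]
  · have h1 : 1 - (√z / √y)⁻¹ ≤ Real.log (√z / √y) :=
      Real.one_sub_inv_le_log_of_pos (by positivity)
    rw [Real.log_div (by positivity) (by positivity), Real.log_sqrt hz.le, Real.log_sqrt hy.le,
      inv_div] at h1
    have h2 := mul_le_mul_of_nonneg_left h1 hz.le
    have h3 : z * (√y / √z) = √z * √y := by
      have := Real.mul_self_sqrt hz.le
      rw [← mul_div_assoc, div_eq_iff (by positivity)]
      linear_combination (-√y) * this
    rw [mul_sub, h3] at h2
    rw [sub_sq, Real.sq_sqrt hz.le, Real.sq_sqrt hy.le]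
    linarith

/-- Pinsker's inequality, with the constant `1 / 4` that comes from comparison with the Hellinger
distance. -/
theorem sq_l1norm_sub_le_bregman {d : ℕ} {z y : Fin d → ℝ} (hz : z ∈ stdSimplex ℝ (Fin d))
    (hy : y ∈ stdSimplex ℝ (Fin d)) (hy0 : ∀ i, 0 < y i) :
    l1norm (z - y) ^ 2 / 4 ≤ bregman negEntropy z y := by
  rw [bregman_negEntropy z hy0]
  have hH : ∑ i, (√(z i) - √(y i)) ^ 2 ≤
      ∑ i, (z i * Real.log (z i) - z i * Real.log (y i) - z i + y i) :=
    Finset.sum_le_sum fun i _ => sq_sqrt_sub_sqrt_le (hz.1 i) (hy0 i)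
  refine le_trans ?_ hH
  have h1 : l1norm (z - y) = ∑ i, |√(z i) - √(y i)| * (√(z i) + √(y i)) := by
    refine Finset.sum_congr rfl fun i _ => ?_
    rw [← abs_of_nonneg (add_nonneg (Real.sqrt_nonneg (z i)) (Real.sqrt_nonneg (y i))), ← abs_mul]
    congr 1
    simp only [Pi.sub_apply]
    linear_combination -Real.mul_self_sqrt (hz.1 i) + Real.mul_self_sqrt (hy.1 i)
  have h2 := Finset.sum_mul_sq_le_sq_mul_sq Finset.univ (fun i => |√(z i) - √(y i)|)
    (fun i => √(z i) + √(y i))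
  rw [← h1] at h2
  simp only [sq_abs] at h2
  have h3 : ∑ i, (√(z i) + √(y i)) ^ 2 ≤ 4 := by
    have : ∀ i ∈ Finset.univ, (√(z i) + √(y i)) ^ 2 ≤ 2 * (z i + y i) := fun i _ => by
      nlinarith [Real.sq_sqrt (hz.1 i), Real.sq_sqrt (hy.1 i), sq_nonneg (√(z i) - √(y i))]
    refine (Finset.sum_le_sum this).trans ?_
    rw [← Finset.mul_sum, Finset.sum_add_distrib, hz.2, hy.2]; norm_num
  have h4 : 0 ≤ ∑ i, (√(z i) - √(y i)) ^ 2 := Finset.sum_nonneg fun i _ => sq_nonneg _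
  nlinarith

theorem bregman_three_point {d : ℕ} (ψ : (Fin d → ℝ) → ℝ) (v z y : Fin d → ℝ) :
    bregman ψ v y - bregman ψ v z - bregman ψ z y =
      (gradVec ψ z - gradVec ψ y) ⬝ᵥ (v - z) := by
  simp only [bregman, sub_dotProduct, dotProduct_sub]
  ring

theorem negEntropy_nonpos {d : ℕ} {x : Fin d → ℝ} (hx : x ∈ stdSimplex ℝ (Fin d)) :
    negEntropy x ≤ 0 :=
  Finset.sum_nonpos fun i _ => Real.mul_log_nonpos (hx.1 i) (mem_Icc_of_mem_stdSimplex hx i).2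

theorem bregman_nonneg {d : ℕ} {z y : Fin d → ℝ} (hz : z ∈ stdSimplex ℝ (Fin d))
    (hy : y ∈ stdSimplex ℝ (Fin d)) (hy0 : ∀ i, 0 < y i) : 0 ≤ bregman negEntropy z y :=
  (by positivity : (0 : ℝ) ≤ l1norm (z - y) ^ 2 / 4).trans (sq_l1norm_sub_le_bregman hz hy hy0)

/-- The divergence from a point whose coordinates are at least `α` is at most `log (1 / α)`. -/
theorem bregman_le_neg_log {d : ℕ} {z y : Fin d → ℝ} {α : ℝ} (hα : 0 < α)
    (hz : z ∈ stdSimplex ℝ (Fin d)) (hy : y ∈ stdSimplex ℝ (Fin d)) (hyα : ∀ i, α ≤ y i) :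
    bregman negEntropy z y ≤ -Real.log α := by
  rw [bregman_negEntropy z fun i => hα.trans_le (hyα i)]
  have h1 : ∀ i ∈ Finset.univ, z i * Real.log (z i) - z i * Real.log (y i) - z i + y i ≤
      z i * (-Real.log α) - z i + y i := fun i _ => by
    have h2 := Real.mul_log_nonpos (hz.1 i) (mem_Icc_of_mem_stdSimplex hz i).2
    have h3 := mul_le_mul_of_nonneg_left (Real.log_le_log hα (hyα i)) (hz.1 i)
    linarith
  refine (Finset.sum_le_sum h1).trans (le_of_eq ?_)
  rw [Finset.sum_add_distrib, Finset.sum_sub_distrib, ← Finset.sum_mul, hz.2, hy.2]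
  ring

/-! ### The shrunk simplex -/

theorem centroid_mem {d : ℕ} (hd : 0 < d) : (fun _ => 1 / (d : ℝ)) ∈ stdSimplex ℝ (Fin d) := by
  refine ⟨fun _ => by positivity, ?_⟩
  have : (d : ℝ) ≠ 0 := by positivity
  simp [this]

theorem shrinkPoint_mem_stdSimplex {d : ℕ} (hd : 0 < d) {α : ℝ} (h0 : 0 ≤ α) (h1 : α ≤ 1)
    {x : Fin d → ℝ} (hx : x ∈ stdSimplex ℝ (Fin d)) : shrinkPoint α x ∈ stdSimplex ℝ (Fin d) :=
  convex_stdSimplex ℝ _ hx (centroid_mem hd) (sub_nonneg.2 h1) h0 (by ring)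

theorem shrunkSimplex_subset {d : ℕ} (hd : 0 < d) {α : ℝ} (h0 : 0 ≤ α) (h1 : α ≤ 1) :
    shrunkSimplex d α ⊆ stdSimplex ℝ (Fin d) := by
  rintro _ ⟨x, hx, rfl⟩
  exact shrinkPoint_mem_stdSimplex hd h0 h1 hx

theorem le_coord_of_mem_shrunkSimplex {d : ℕ} {α : ℝ} (h1 : α ≤ 1)
    {x : Fin d → ℝ} (hx : x ∈ shrunkSimplex d α) (i : Fin d) : α / d ≤ x i := by
  obtain ⟨z, hz, rfl⟩ := hx
  have := mul_nonneg (sub_nonneg.2 h1) (hz.1 i)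
  simp only [shrinkPoint, Pi.add_apply, Pi.smul_apply, smul_eq_mul, mul_one_div]
  linarith

theorem pos_of_mem_shrunkSimplex {d : ℕ} {α : ℝ} (h0 : 0 < α) (h1 : α ≤ 1)
    {x : Fin d → ℝ} (hx : x ∈ shrunkSimplex d α) (i : Fin d) : 0 < x i := by
  have : (0 : ℝ) < d := by exact_mod_cast i.pos
  exact (by positivity : 0 < α / d).trans_le (le_coord_of_mem_shrunkSimplex h1 hx i)

theorem convex_shrunkSimplex (d : ℕ) (α : ℝ) : Convex ℝ (shrunkSimplex d α) := by
  rintro _ ⟨x, hx, rfl⟩ _ ⟨y, hy, rfl⟩ a b ha hb hab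
  refine ⟨a • x + b • y, convex_stdSimplex ℝ _ hx hy ha hb hab, ?_⟩
  obtain rfl : b = 1 - a := by linarith
  unfold shrinkPoint
  module

theorem isCompact_shrunkSimplex (d : ℕ) (α : ℝ) : IsCompact (shrunkSimplex d α) := by
  refine (isCompact_stdSimplex ℝ (Fin d)).image ?_
  unfold shrinkPoint
  fun_prop

theorem shrunkSimplex_nonempty {d : ℕ} (hd : 0 < d) (α : ℝ) : (shrunkSimplex d α).Nonempty :=
  ⟨_, _, centroid_mem hd, rfl⟩

theorem shrinkPoint_sub {d : ℕ} (α : ℝ) (x y : Fin d → ℝ) :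
    shrinkPoint α x - shrinkPoint α y = (1 - α) • (x - y) := by
  unfold shrinkPoint; module

theorem l1norm_shrinkPoint_sub_self_le {d : ℕ} (hd : 0 < d) {α : ℝ} (h0 : 0 ≤ α)
    {x : Fin d → ℝ} (hx : x ∈ stdSimplex ℝ (Fin d)) : l1norm (shrinkPoint α x - x) ≤ 2 * α := by
  have : shrinkPoint α x - x = α • ((fun _ => 1 / (d : ℝ)) - x) := by
    unfold shrinkPoint; module
  rw [this, l1norm_smul, abs_of_nonneg h0, mul_comm]
  exact mul_le_mul_of_nonneg_right (l1norm_sub_simplex_le (centroid_mem hd) hx) h0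

/-! ### The mirror descent step -/

/-- The minimizer over the shrunk simplex of the entropy plus a linear function. -/
def mirrorMap (d : ℕ) (α : ℝ) (ξ : Fin d → ℝ) : Fin d → ℝ :=
  argminOn (shrunkSimplex d α) (fun z => ξ ⬝ᵥ z + negEntropy z)

theorem argminOn_spec {d : ℕ} {S : Set (Fin d → ℝ)} {F : (Fin d → ℝ) → ℝ}
    (h : ∃ y, y ∈ S ∧ IsMinOn F S y) : argminOn S F ∈ S ∧ IsMinOn F S (argminOn S F) := by
  rw [argminOn, dif_pos h]
  exact h.choose_spec

theorem mirrorMap_spec {d : ℕ} (hd : 0 < d) (α : ℝ) (ξ : Fin d → ℝ) :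
    mirrorMap d α ξ ∈ shrunkSimplex d α ∧
      IsMinOn (fun z => ξ ⬝ᵥ z + negEntropy z) (shrunkSimplex d α) (mirrorMap d α ξ) := by
  refine argminOn_spec ((isCompact_shrunkSimplex d α).exists_isMinOn
    (shrunkSimplex_nonempty hd α) (Continuous.continuousOn ?_))
  exact (continuous_const.dotProduct continuous_id).add continuous_negEntropy

/-- The first-order optimality condition of the mirror descent step. -/
theorem first_order_optimality {d : ℕ} {α : ℝ} (h0 : 0 < α) (h1 : α ≤ 1) {ξ z v : Fin d → ℝ}
    (hz : z ∈ shrunkSimplex d α)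
    (hmin : IsMinOn (fun z => ξ ⬝ᵥ z + negEntropy z) (shrunkSimplex d α) z)
    (hv : v ∈ shrunkSimplex d α) : 0 ≤ (ξ + gradVec negEntropy z) ⬝ᵥ (v - z) := by
  have hpos := pos_of_mem_shrunkSimplex h0 h1 hz
  have hlin : HasFDerivAt (fun z => ξ ⬝ᵥ z)
      (LinearMap.toContinuousLinearMap (dotProductBilin ℝ ℝ ξ : (Fin d → ℝ) →ₗ[ℝ] ℝ)) z :=
    (LinearMap.toContinuousLinearMap (dotProductBilin ℝ ℝ ξ : (Fin d → ℝ) →ₗ[ℝ] ℝ)).hasFDerivAt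
  have hder := (hlin.add (hasFDerivAt_negEntropy hpos)).hasFDerivWithinAt
    (s := shrunkSimplex d α)
  have := (hmin.localize).hasFDerivWithinAt_nonneg hder
    (sub_mem_posTangentConeAt_of_segment_subset ((convex_shrunkSimplex d α).segment_subset hz hv))
  rw [add_apply, hasFDerivAt_negEntropy_apply hpos] at this
  rw [add_dotProduct]
  exact this

/-- Strong convexity makes the minimizer a Lipschitz function of the linear part. -/
theorem l1norm_sub_minimizer_le {d : ℕ} (hd : 0 < d) {α : ℝ} (h0 : 0 < α) (h1 : α ≤ 1)
    {ξ ξ' z z' : Fin d → ℝ}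
    (hz : z ∈ shrunkSimplex d α)
    (hmin : IsMinOn (fun z => ξ ⬝ᵥ z + negEntropy z) (shrunkSimplex d α) z)
    (hz' : z' ∈ shrunkSimplex d α)
    (hmin' : IsMinOn (fun z => ξ' ⬝ᵥ z + negEntropy z) (shrunkSimplex d α) z') :
    l1norm (z - z') ≤ 2 * ‖ξ - ξ'‖ := by
  have hs := shrunkSimplex_subset hd h0.le h1
  have e1 := first_order_optimality h0 h1 hz hmin hz'
  have e2 := first_order_optimality h0 h1 hz' hmin' hz
  have p1 := sq_l1norm_sub_le_bregman (hs hz) (hs hz') (pos_of_mem_shrunkSimplex h0 h1 hz')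
  have p2 := sq_l1norm_sub_le_bregman (hs hz') (hs hz) (pos_of_mem_shrunkSimplex h0 h1 hz)
  rw [l1norm_sub_comm] at p2
  have h3 : bregman negEntropy z z' + bregman negEntropy z' z =
      (gradVec negEntropy z' - gradVec negEntropy z) ⬝ᵥ (z' - z) := by
    simp only [bregman, sub_dotProduct, dotProduct_sub]; ring
  have h4 : (ξ - ξ') ⬝ᵥ (z' - z) = (ξ + gradVec negEntropy z) ⬝ᵥ (z' - z) +
      (ξ' + gradVec negEntropy z') ⬝ᵥ (z - z') +
      (gradVec negEntropy z' - gradVec negEntropy z) ⬝ᵥ (z' - z) := by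
    simp only [add_dotProduct, sub_dotProduct, dotProduct_sub]; ring
  have h5 := (le_abs_self _).trans (abs_dotProduct_le (ξ - ξ') (z' - z))
  rw [l1norm_sub_comm] at h5
  have h6 : l1norm (z - z') ^ 2 / 2 ≤ ‖ξ - ξ'‖ * l1norm (z - z') := by linarith
  rcases (l1norm_nonneg (z - z')).eq_or_lt with h | h
  · rw [← h]; positivity
  · nlinarith

theorem eq_of_l1norm_sub_le_zero {d : ℕ} {x y : Fin d → ℝ} (h : l1norm (x - y) ≤ 0) : x = y := by
  ext i
  have := (abs_coord_le_l1norm (x - y) i).trans h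
  exact sub_eq_zero.1 (abs_nonpos_iff.1 this)

theorem norm_le_l1norm {d : ℕ} (x : Fin d → ℝ) : ‖x‖ ≤ l1norm x :=
  (pi_norm_le_iff_of_nonneg (l1norm_nonneg x)).2 fun i => abs_coord_le_l1norm x i

theorem continuous_mirrorMap {d : ℕ} (hd : 0 < d) {α : ℝ} (h0 : 0 < α) (h1 : α ≤ 1) :
    Continuous (mirrorMap d α) := by
  refine (LipschitzWith.of_dist_le_mul (K := 2) fun ξ ξ' => ?_).continuous
  rw [dist_eq_norm, dist_eq_norm]
  obtain ⟨a1, a2⟩ := mirrorMap_spec hd α ξ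
  obtain ⟨b1, b2⟩ := mirrorMap_spec hd α ξ'
  exact (norm_le_l1norm _).trans (l1norm_sub_minimizer_le hd h0 h1 a1 a2 b1 b2)

theorem mirrorStep_eq {d : ℕ} (hd : 0 < d) {α : ℝ} (h0 : 0 < α) (h1 : α ≤ 1) {η : ℝ} (hη : 0 < η)
    (g y : Fin d → ℝ) :
    argminOn (shrunkSimplex d α) (fun z => g ⬝ᵥ z + 1 / η * bregman negEntropy z y) =
      mirrorMap d α (η • g - gradVec negEntropy y) := by
  set ξ := η • g - gradVec negEntropy y with hξ
  have hF : ∀ z, g ⬝ᵥ z + 1 / η * bregman negEntropy z y = 1 / η * (ξ ⬝ᵥ z + negEntropy z) +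
      1 / η * (gradVec negEntropy y ⬝ᵥ y - negEntropy y) := by
    intro z
    rw [hξ, sub_dotProduct, smul_dotProduct, bregman, dotProduct_sub, smul_eq_mul]
    field_simp
    ring
  have hiff : ∀ z, IsMinOn (fun z => g ⬝ᵥ z + 1 / η * bregman negEntropy z y)
      (shrunkSimplex d α) z ↔
      IsMinOn (fun z => ξ ⬝ᵥ z + negEntropy z) (shrunkSimplex d α) z := by
    intro z
    simp only [isMinOn_iff, hF, add_le_add_iff_right]
    refine forall₂_congr fun x _ => ?_
    exact mul_le_mul_iff_right₀ (by positivity)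
  obtain ⟨a1, a2⟩ := mirrorMap_spec hd α ξ
  obtain ⟨b1, b2⟩ := argminOn_spec ⟨_, a1, (hiff _).2 a2⟩
  refine eq_of_l1norm_sub_le_zero ?_
  simpa using l1norm_sub_minimizer_le hd h0 h1 b1 ((hiff _).1 b2) a1 a2

/-- The one-step inequality of mirror descent. -/
theorem mirrorStep_regret {d : ℕ} (hd : 0 < d) {α : ℝ} (h0 : 0 < α) (h1 : α ≤ 1) (η : ℝ)
    (g : Fin d → ℝ) {y v : Fin d → ℝ} (hy : y ∈ shrunkSimplex d α) (hv : v ∈ shrunkSimplex d α) :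
    η * (g ⬝ᵥ (y - v)) ≤ bregman negEntropy v y -
      bregman negEntropy v (mirrorMap d α (η • g - gradVec negEntropy y)) + η ^ 2 * ‖g‖ ^ 2 := by
  obtain ⟨a1, a2⟩ := mirrorMap_spec hd α (η • g - gradVec negEntropy y)
  set z := mirrorMap d α (η • g - gradVec negEntropy y)
  have hs := shrunkSimplex_subset hd h0.le h1
  have e1 := first_order_optimality h0 h1 a1 a2 hv
  have e2 := bregman_three_point negEntropy v z y
  have e3 := sq_l1norm_sub_le_bregman (hs a1) (hs hy) (pos_of_mem_shrunkSimplex h0 h1 hy)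
  have e4 := (le_abs_self _).trans (abs_dotProduct_le (η • g) (y - z))
  rw [norm_smul, l1norm_sub_comm] at e4
  have e5 : η * (g ⬝ᵥ (y - v)) = (η • g) ⬝ᵥ (y - z) - (η • g) ⬝ᵥ (v - z) := by
    simp only [smul_dotProduct, dotProduct_sub, smul_eq_mul]; ring
  have e6 : (η • g - gradVec negEntropy y + gradVec negEntropy z) ⬝ᵥ (v - z) =
      (η • g) ⬝ᵥ (v - z) + (gradVec negEntropy z - gradVec negEntropy y) ⬝ᵥ (v - z) := by
    simp only [add_dotProduct, sub_dotProduct]; ring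
  have e7 : (‖η‖ * ‖g‖) ^ 2 = η ^ 2 * ‖g‖ ^ 2 := by rw [mul_pow, Real.norm_eq_abs, sq_abs]
  nlinarith [sq_nonneg (‖η‖ * ‖g‖ - l1norm (z - y) / 2)]

/-! ### Regret of the meta learner and of the base learners on the surrogate losses -/

/-- The qualitative part of the parameter setting, on which the deterministic analysis relies. -/
structure PBMDInput.IsEntropic {d : ℕ} (A : PBMDInput d) : Prop where
  dim_pos : 0 < d
  mirror : A.ψ = negEntropy
  μ_pos : 0 < A.μ
  μ_lt_one : A.μ < 1
  dom : A.dom = shrunkSimplex d A.μ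
  N_pos : 0 < A.N
  γ_pos : 0 < A.γ
  init_mem : ∀ k ∈ Finset.Icc 1 A.N, A.init k ∈ shrunkSimplex d A.μ
  step_pos : ∀ k ∈ Finset.Icc 1 A.N, 0 < A.stepSize k

/-- A state with feasible iterates and a probability vector of weights. -/
structure PBMDInput.IsValid {d : ℕ} (A : PBMDInput d) (st : PBMDState d) : Prop where
  iter_mem : ∀ k ∈ Finset.Icc 1 A.N, st.iter k ∈ shrunkSimplex d A.μ
  weight_pos : ∀ k ∈ Finset.Icc 1 A.N, 0 < st.weight k
  weight_sum : ∑ k ∈ Finset.Icc 1 A.N, st.weight k = 1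

theorem sum_Icc_one_div_mul_succ (N : ℕ) :
    ∑ k ∈ Finset.Icc 1 N, 1 / ((k : ℝ) * (k + 1)) = N / (N + 1) := by
  induction N with
  | zero => simp
  | succ n ih =>
    rw [Finset.sum_Icc_succ_top (by omega), ih]
    push_cast
    field_simp
    ring

theorem exp_le_add_exp_sq (x : ℝ) : Real.exp x ≤ x + Real.exp (x ^ 2) := by
  have h1 := Real.add_one_le_exp (x ^ 2)
  by_cases hx : |x| ≤ 1
  · have := (abs_le.1 (Real.abs_exp_sub_one_sub_id_le hx)).2
    linarith
  · rcases lt_abs.1 (not_le.1 hx) with h | h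
    · have : Real.exp x ≤ Real.exp (x ^ 2) := Real.exp_le_exp.2 (by nlinarith)
      linarith
    · have : Real.exp x ≤ 1 := Real.exp_le_one_iff.2 (by linarith)
      nlinarith

namespace PBMDInput

variable {d : ℕ} {A : PBMDInput d}

theorem isValid_initState (hN : 0 < A.N)
    (hinit : ∀ k ∈ Finset.Icc 1 A.N, A.init k ∈ shrunkSimplex d A.μ) :
    A.IsValid A.initState where
  iter_mem := hinit
  weight_pos := fun k hk => by
    have : (0 : ℝ) < A.N := by exact_mod_cast hN
    have : (0 : ℝ) < k := by exact_mod_cast (Finset.mem_Icc.1 hk).1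
    simp only [initState]
    positivity
  weight_sum := by
    have : (0 : ℝ) < A.N := by exact_mod_cast hN
    simp only [initState]
    rw [← Finset.mul_sum, sum_Icc_one_div_mul_succ]
    field_simp

theorem IsValid.combine_mem {st : PBMDState d} (hst : A.IsValid st) :
    A.combine st ∈ shrunkSimplex d A.μ :=
  (convex_shrunkSimplex d A.μ).sum_mem (fun k hk => (hst.weight_pos k hk).le) hst.weight_sum
    hst.iter_mem

theorem IsEntropic.shrunk_subset (hA : A.IsEntropic) :
    shrunkSimplex d A.μ ⊆ stdSimplex ℝ (Fin d) :=
  shrunkSimplex_subset hA.dim_pos hA.μ_pos.le hA.μ_lt_one.le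

theorem IsEntropic.iter_step (hA : A.IsEntropic) {st : PBMDState d} (f : (Fin d → ℝ) → ℝ)
    (s : Fin d → ℝ) {k : ℕ} (hk : k ∈ Finset.Icc 1 A.N) :
    (A.step st f s).iter k =
      mirrorMap d A.μ (A.stepSize k • A.estimator st f s - gradVec negEntropy (st.iter k)) := by
  simp only [step]
  rw [hA.dom, hA.mirror]
  exact mirrorStep_eq hA.dim_pos hA.μ_pos hA.μ_lt_one.le (hA.step_pos k hk) _ _

/-- The normalizing constant of the multiplicative weight update. -/
def normalizer (A : PBMDInput d) (st : PBMDState d) (f : (Fin d → ℝ) → ℝ) (s : Fin d → ℝ) : ℝ :=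
  ∑ j ∈ Finset.Icc 1 A.N, st.weight j * Real.exp (-A.γ * A.surrogate st f s (st.iter j))

theorem IsValid.normalizer_pos (hA : A.IsEntropic) {st : PBMDState d} (hst : A.IsValid st)
    (f : (Fin d → ℝ) → ℝ) (s : Fin d → ℝ) : 0 < A.normalizer st f s :=
  Finset.sum_pos (fun k hk => mul_pos (hst.weight_pos k hk) (Real.exp_pos _))
    ⟨1, Finset.mem_Icc.2 ⟨le_rfl, hA.N_pos⟩⟩

theorem IsEntropic.isValid_step (hA : A.IsEntropic) {st : PBMDState d} (hst : A.IsValid st)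
    (f : (Fin d → ℝ) → ℝ) (s : Fin d → ℝ) : A.IsValid (A.step st f s) where
  iter_mem := fun k hk => by
    rw [hA.iter_step f s hk]
    exact (mirrorMap_spec hA.dim_pos _ _).1
  weight_pos := fun k hk =>
    div_pos (mul_pos (hst.weight_pos k hk) (Real.exp_pos _)) (hst.normalizer_pos hA f s)
  weight_sum := by
    simp only [step]
    rw [← Finset.sum_div]
    exact div_self (hst.normalizer_pos hA f s).ne'

theorem IsEntropic.isValid_state (hA : A.IsEntropic) (f : ℕ → (Fin d → ℝ) → ℝ)
    (s : ℕ → (Fin d → ℝ)) (t : ℕ) : A.IsValid (A.state f s t) := by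
  induction t with
  | zero => exact isValid_initState hA.N_pos hA.init_mem
  | succ t ih => exact hA.isValid_step ih _ _

/-- The surrogate loss has mean zero under the weights, so the normalizing constant is
at most the exponential of a second-order term. -/
theorem IsValid.normalizer_le (hA : A.IsEntropic) {st : PBMDState d} (hst : A.IsValid st)
    (f : (Fin d → ℝ) → ℝ) (s : Fin d → ℝ) :
    A.normalizer st f s ≤ Real.exp (4 * A.γ ^ 2 * ‖A.estimator st f s‖ ^ 2) := by
  have hmean : ∑ k ∈ Finset.Icc 1 A.N, st.weight k * A.surrogate st f s (st.iter k) = 0 := by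
    have h1 : ∀ k, st.weight k * A.surrogate st f s (st.iter k) =
        A.estimator st f s ⬝ᵥ (st.weight k • st.iter k) -
          st.weight k * (A.estimator st f s ⬝ᵥ A.combine st) := by
      intro k
      simp only [surrogate, dotProduct_sub, dotProduct_smul, smul_eq_mul]
      ring
    simp_rw [h1]
    rw [Finset.sum_sub_distrib, ← dotProduct_sum, ← Finset.sum_mul, hst.weight_sum, one_mul]
    exact sub_self _
  have hbound : ∀ k ∈ Finset.Icc 1 A.N,
      Real.exp (-A.γ * A.surrogate st f s (st.iter k)) ≤
        -A.γ * A.surrogate st f s (st.iter k) +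
          Real.exp (4 * A.γ ^ 2 * ‖A.estimator st f s‖ ^ 2) := by
    intro k hk
    refine (exp_le_add_exp_sq _).trans (add_le_add le_rfl (Real.exp_le_exp.2 ?_))
    have h1 : |A.surrogate st f s (st.iter k)| ≤ ‖A.estimator st f s‖ * 2 :=
      (abs_dotProduct_le _ _).trans (mul_le_mul_of_nonneg_left
        (l1norm_sub_simplex_le (hA.shrunk_subset (hst.iter_mem k hk))
          (hA.shrunk_subset hst.combine_mem)) (norm_nonneg _))
    have h2 := pow_le_pow_left₀ (abs_nonneg _) h1 2
    rw [sq_abs] at h2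
    have := mul_le_mul_of_nonneg_left h2 (sq_nonneg A.γ)
    nlinarith
  calc A.normalizer st f s ≤ ∑ k ∈ Finset.Icc 1 A.N, st.weight k *
        (-A.γ * A.surrogate st f s (st.iter k) +
          Real.exp (4 * A.γ ^ 2 * ‖A.estimator st f s‖ ^ 2)) :=
      Finset.sum_le_sum fun k hk => mul_le_mul_of_nonneg_left (hbound k hk) (hst.weight_pos k hk).le
    _ = -A.γ * ∑ k ∈ Finset.Icc 1 A.N, st.weight k * A.surrogate st f s (st.iter k) +
        (∑ k ∈ Finset.Icc 1 A.N, st.weight k) *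
          Real.exp (4 * A.γ ^ 2 * ‖A.estimator st f s‖ ^ 2) := by
      rw [Finset.mul_sum, Finset.sum_mul, ← Finset.sum_add_distrib]
      exact Finset.sum_congr rfl fun k _ => by ring
    _ = _ := by rw [hmean, hst.weight_sum]; ring

theorem IsEntropic.log_weight_step (hA : A.IsEntropic) {st : PBMDState d} (hst : A.IsValid st)
    (f : (Fin d → ℝ) → ℝ) (s : Fin d → ℝ) {k : ℕ} (hk : k ∈ Finset.Icc 1 A.N) :
    A.γ * (A.estimator st f s ⬝ᵥ (A.combine st - st.iter k)) ≤
      Real.log ((A.step st f s).weight k) - Real.log (st.weight k) +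
        4 * A.γ ^ 2 * ‖A.estimator st f s‖ ^ 2 := by
  have hZ := hst.normalizer_pos hA f s
  have h1 : (A.step st f s).weight k =
      st.weight k * Real.exp (-A.γ * A.surrogate st f s (st.iter k)) / A.normalizer st f s := rfl
  have h2 : Real.log (A.normalizer st f s) ≤ 4 * A.γ ^ 2 * ‖A.estimator st f s‖ ^ 2 := by
    rw [Real.log_le_iff_le_exp hZ]; exact hst.normalizer_le hA f s
  rw [h1, Real.log_div (mul_pos (hst.weight_pos k hk) (Real.exp_pos _)).ne' hZ.ne',
    Real.log_mul (hst.weight_pos k hk).ne' (Real.exp_pos _).ne', Real.log_exp]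
  have h3 : A.surrogate st f s (st.iter k) =
      -(A.estimator st f s ⬝ᵥ (A.combine st - st.iter k)) := by
    simp only [surrogate, dotProduct_sub]; ring
  rw [h3]
  linarith

/-- The regret of the meta learner against the base learner `k`. -/
theorem IsEntropic.meta_regret (hA : A.IsEntropic) (f : ℕ → (Fin d → ℝ) → ℝ)
    (s : ℕ → (Fin d → ℝ)) {k : ℕ} (hk : k ∈ Finset.Icc 1 A.N) (T : ℕ) :
    A.γ * ∑ t ∈ Finset.range T, A.estimator (A.state f s t) (f t) (s t) ⬝ᵥ
        (A.combine (A.state f s t) - (A.state f s t).iter k) ≤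
      -Real.log (A.initState.weight k) +
        4 * A.γ ^ 2 * ∑ t ∈ Finset.range T, ‖A.estimator (A.state f s t) (f t) (s t)‖ ^ 2 := by
  have key : A.γ * ∑ t ∈ Finset.range T, A.estimator (A.state f s t) (f t) (s t) ⬝ᵥ
        (A.combine (A.state f s t) - (A.state f s t).iter k) ≤
      Real.log ((A.state f s T).weight k) - Real.log (A.initState.weight k) +
        4 * A.γ ^ 2 * ∑ t ∈ Finset.range T, ‖A.estimator (A.state f s t) (f t) (s t)‖ ^ 2 := by
    induction T with
    | zero => simp [state]
    | succ T ih =>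
      have := hA.log_weight_step (hA.isValid_state f s T) (f T) (s T) hk
      rw [Finset.sum_range_succ, Finset.sum_range_succ, mul_add, mul_add]
      simp only [state]
      linarith
  have hv := hA.isValid_state f s T
  have h1 : (A.state f s T).weight k ≤ 1 := by
    rw [← hv.weight_sum]
    exact Finset.single_le_sum (fun j hj => (hv.weight_pos j hj).le) hk
  have := Real.log_nonpos (hv.weight_pos k hk).le h1
  linarith

/-- The dynamic regret of the base learner `k`. -/
theorem IsEntropic.base_regret (hA : A.IsEntropic) (f : ℕ → (Fin d → ℝ) → ℝ)
    (s : ℕ → (Fin d → ℝ)) {k : ℕ} (hk : k ∈ Finset.Icc 1 A.N) {Γ : ℝ}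
    (hΓ : ∀ x ∈ shrunkSimplex d A.μ, ‖gradVec negEntropy x‖ ≤ Γ) (v : ℕ → (Fin d → ℝ)) (T : ℕ)
    (hv : ∀ t ≤ T, v t ∈ shrunkSimplex d A.μ) :
    A.stepSize k * ∑ t ∈ Finset.range T, A.estimator (A.state f s t) (f t) (s t) ⬝ᵥ
        ((A.state f s t).iter k - v t) ≤
      bregman negEntropy (v 0) (A.init k) + (negEntropy (v T) - negEntropy (v 0)) +
        Γ * pathVariation T v +
        A.stepSize k ^ 2 *
          ∑ t ∈ Finset.range T, ‖A.estimator (A.state f s t) (f t) (s t)‖ ^ 2 := by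
  have key : A.stepSize k * ∑ t ∈ Finset.range T, A.estimator (A.state f s t) (f t) (s t) ⬝ᵥ
        ((A.state f s t).iter k - v t) ≤
      bregman negEntropy (v 0) (A.init k) - bregman negEntropy (v T) ((A.state f s T).iter k) +
        (negEntropy (v T) - negEntropy (v 0)) + Γ * pathVariation T v +
        A.stepSize k ^ 2 *
          ∑ t ∈ Finset.range T, ‖A.estimator (A.state f s t) (f t) (s t)‖ ^ 2 := by
    induction T with
    | zero => simp [state, initState, pathVariation]
    | succ T ih =>
      have ih := ih fun t ht => hv t (ht.trans (Nat.le_succ T))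
      have hst := hA.isValid_state f s T
      have hst' := hA.isValid_state f s (T + 1)
      have h1 := mirrorStep_regret hA.dim_pos hA.μ_pos hA.μ_lt_one.le (A.stepSize k)
        (A.estimator (A.state f s T) (f T) (s T)) (hst.iter_mem k hk) (hv T (Nat.le_succ T))
      rw [← hA.iter_step (f T) (s T) hk] at h1
      change _ ≤ _ - bregman negEntropy (v T) ((A.state f s (T + 1)).iter k) + _ at h1
      set y := (A.state f s (T + 1)).iter k
      have h2 : bregman negEntropy (v T) y = bregman negEntropy (v (T + 1)) y -
          (negEntropy (v (T + 1)) - negEntropy (v T)) +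
          gradVec negEntropy y ⬝ᵥ (v (T + 1) - v T) := by
        simp only [bregman, dotProduct_sub]; ring
      have h3 : -Γ * l1norm (v (T + 1) - v T) ≤ gradVec negEntropy y ⬝ᵥ (v (T + 1) - v T) := by
        have := (abs_le.1 (abs_dotProduct_le (gradVec negEntropy y) (v (T + 1) - v T))).1
        have := mul_le_mul_of_nonneg_right (hΓ y (hst'.iter_mem k hk))
          (l1norm_nonneg (v (T + 1) - v T))
        linarith
      rw [Finset.sum_range_succ, Finset.sum_range_succ, mul_add, mul_add]
      have h4 : pathVariation (T + 1) v = pathVariation T v + l1norm (v (T + 1) - v T) :=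
        Finset.sum_range_succ _ _
      rw [h4, mul_add]
      linarith
  have hst := hA.isValid_state f s T
  have := bregman_nonneg (hA.shrunk_subset (hv T le_rfl)) (hA.shrunk_subset (hst.iter_mem k hk))
    (pos_of_mem_shrunkSimplex hA.μ_pos hA.μ_lt_one.le (hst.iter_mem k hk))
  linarith

end PBMDInput

/-! ### Expectations over one round -/

/-- The two-point gradient estimator at the point `y`, with sampled direction `s`. The estimator of
the algorithm is, by definition, this one at the combined decision. -/
def twoPointEstimator {d : ℕ} (μ : ℝ) (f : (Fin d → ℝ) → ℝ) (y s : Fin d → ℝ) : Fin d → ℝ :=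
  ((d : ℝ) / (2 * μ) * (f (y + μ • s) - f (y - μ • s))) • signVec s

theorem measurable_twoPointEstimator {d : ℕ} (μ : ℝ) {f : (Fin d → ℝ) → ℝ} (hf : Continuous f) :
    Measurable fun p : (Fin d → ℝ) × (Fin d → ℝ) => twoPointEstimator μ f p.2 p.1 := by
  unfold twoPointEstimator
  have h : Continuous fun p : (Fin d → ℝ) × (Fin d → ℝ) =>
      (d : ℝ) / (2 * μ) * (f (p.2 + μ • p.1) - f (p.2 - μ • p.1)) := by fun_prop
  exact h.measurable.smul (measurable_signVec.comp measurable_fst)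

theorem measurable_fun_dotProduct {Ω : Type*} [MeasurableSpace Ω] {d : ℕ} {X Y : Ω → (Fin d → ℝ)}
    (hX : Measurable X) (hY : Measurable Y) : Measurable fun ω => X ω ⬝ᵥ Y ω := by
  unfold dotProduct
  exact Finset.measurable_fun_sum _ fun i _ =>
    ((measurable_pi_apply i).comp hX).mul ((measurable_pi_apply i).comp hY)

/-- Integrating out a random variable that is independent of another one. -/
theorem integral_comp_of_indepFun {Ω α β : Type*} [MeasurableSpace Ω] [MeasurableSpace α]
    [MeasurableSpace β] {P : Measure Ω} [IsProbabilityMeasure P] {X : Ω → α} {Y : Ω → β}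
    (hX : Measurable X) (hY : Measurable Y) (hXY : IndepFun X Y P) {H : α × β → ℝ}
    (hH : Measurable H) (hint : Integrable (fun ω => H (X ω, Y ω)) P) :
    Integrable (fun ω => ∫ x, H (x, Y ω) ∂(P.map X)) P ∧
      ∫ ω, H (X ω, Y ω) ∂P = ∫ ω, (∫ x, H (x, Y ω) ∂(P.map X)) ∂P := by
  have := Measure.isProbabilityMeasure_map (μ := P) hX.aemeasurable
  have := Measure.isProbabilityMeasure_map (μ := P) hY.aemeasurable
  have hmap := hXY.map_prod_eq_prod_map_map hX.aemeasurable hY.aemeasurable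
  have hint' : Integrable H ((P.map X).prod (P.map Y)) := by
    rw [← hmap, integrable_map_measure hH.aestronglyMeasurable (hX.prodMk hY).aemeasurable]
    exact hint
  have h1 : Integrable (fun y => ∫ x, H (x, y) ∂(P.map X)) (P.map Y) := hint'.integral_prod_right
  refine ⟨(integrable_map_measure h1.aestronglyMeasurable hY.aemeasurable).1 h1, ?_⟩
  rw [← integral_map (f := fun y => ∫ x, H (x, y) ∂(P.map X)) hY.aemeasurable
    h1.aestronglyMeasurable, ← integral_prod_symm H hint', ← hmap,
    integral_map (hX.prodMk hY).aemeasurable hH.aestronglyMeasurable]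

theorem self_mem_simplexNhd {d : ℕ} {μ : ℝ} (hμ : 0 ≤ μ) {y : Fin d → ℝ}
    (hy : y ∈ stdSimplex ℝ (Fin d)) : y ∈ simplexNhd d μ := by
  simpa using add_smul_mem_simplexNhd hμ hy (x := 0) (by simp [l1norm])

section Round

variable {d : ℕ} {f : (Fin d → ℝ) → ℝ} {μ G : ℝ}

theorem norm_twoPointEstimator_sq_le (y s : Fin d → ℝ) :
    ‖twoPointEstimator μ f y s‖ ^ 2 ≤
      (d / (2 * μ)) ^ 2 * (f (y + μ • s) - f (y + μ • -s)) ^ 2 := by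
  rw [← mul_pow, smul_neg, ← sub_eq_add_neg, ← sq_abs (_ * _)]
  refine pow_le_pow_left₀ (norm_nonneg _) ?_ 2
  rw [twoPointEstimator, norm_smul, Real.norm_eq_abs]
  exact mul_le_of_le_one_right (abs_nonneg _) (norm_signVec_le s)

theorem lipschitz_smoothing_bound (hμ : 0 < μ)
    (hL : ∀ x ∈ simplexNhd d μ, ∀ y ∈ simplexNhd d μ, |f x - f y| ≤ G * l1norm (x - y))
    {y : Fin d → ℝ} (hy : y ∈ stdSimplex ℝ (Fin d)) {a b : Fin d → ℝ} (ha : l1norm a ≤ 1)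
    (hb : l1norm b ≤ 1) : |f (y + μ • a) - f (y + μ • b)| ≤ G * μ * l1norm (a - b) := by
  refine (hL _ (add_smul_mem_simplexNhd hμ.le hy ha) _
    (add_smul_mem_simplexNhd hμ.le hy hb)).trans (le_of_eq ?_)
  rw [add_sub_add_left_eq_sub, ← smul_sub, l1norm_smul, abs_of_pos hμ, mul_assoc]

theorem norm_twoPointEstimator_le (hμ : 0 < μ)
    (hL : ∀ x ∈ simplexNhd d μ, ∀ y ∈ simplexNhd d μ, |f x - f y| ≤ G * l1norm (x - y))
    {y s : Fin d → ℝ} (hy : y ∈ stdSimplex ℝ (Fin d)) (hs : l1norm s = 1) :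
    ‖twoPointEstimator μ f y s‖ ≤ d * G := by
  have h1 := lipschitz_smoothing_bound hμ hL hy hs.le
    (show l1norm (-s) ≤ 1 by rw [l1norm_neg]; exact hs.le)
  have h2 : l1norm (s - -s) = 2 := by
    rw [show s - -s = (2 : ℝ) • s by rw [two_smul]; abel, l1norm_smul, hs, abs_two, mul_one]
  rw [h2, smul_neg, ← sub_eq_add_neg] at h1
  rw [twoPointEstimator, norm_smul, Real.norm_eq_abs, abs_mul,
    abs_of_nonneg (by positivity : (0 : ℝ) ≤ d / (2 * μ))]
  refine (mul_le_of_le_one_right (by positivity) (norm_signVec_le s)).trans ?_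
  calc d / (2 * μ) * |f (y + μ • s) - f (y - μ • s)| ≤ d / (2 * μ) * (G * μ * 2) :=
        mul_le_mul_of_nonneg_left h1 (by positivity)
    _ = d * G := by field_simp

variable {Ω : Type*} [MeasurableSpace Ω] {P : Measure Ω} {X Y : Ω → (Fin d → ℝ)}

theorem ae_l1norm_eq_one (hd : 0 < d) (hX : Measurable X) (hlaw : P.map X = unifL1Sphere d) :
    ∀ᵐ ω ∂P, l1norm (X ω) = 1 := by
  have := ae_unifL1Sphere_l1norm hd
  rw [← hlaw] at this
  exact ae_of_ae_map hX.aemeasurable this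

variable [IsProbabilityMeasure P]

theorem integrable_round_loss (hd : 0 < d) (hf : Continuous f) (μ : ℝ)
    (hX : Measurable X) (hY : Measurable Y) (hlaw : P.map X = unifL1Sphere d)
    (hYm : ∀ ω, Y ω ∈ stdSimplex ℝ (Fin d)) (c : ℝ) :
    Integrable (fun ω => (f (Y ω + μ • X ω) + f (Y ω - μ • X ω)) / 2 - c) P := by
  have hc : Continuous fun p : (Fin d → ℝ) × (Fin d → ℝ) =>
    (f (p.2 + μ • p.1) + f (p.2 - μ • p.1)) / 2 - c := by fun_prop
  have hK : IsCompact ({x : Fin d → ℝ | l1norm x ≤ 1} ×ˢ stdSimplex ℝ (Fin d)) :=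
    (isCompact_l1norm_le 1).prod (isCompact_stdSimplex ℝ (Fin d))
  obtain ⟨M, hM⟩ := hK.exists_bound_of_continuousOn hc.continuousOn
  refine Integrable.of_bound (hc.measurable.comp (hX.prodMk hY)).aestronglyMeasurable M ?_
  filter_upwards [ae_l1norm_eq_one hd hX hlaw] with ω hω
  exact hM (X ω, Y ω) ⟨hω.le, hYm ω⟩

theorem measurable_estimator_comp (μ : ℝ) (hf : Continuous f) (hX : Measurable X)
    (hY : Measurable Y) : Measurable fun ω => twoPointEstimator μ f (Y ω) (X ω) :=
  (measurable_twoPointEstimator μ hf).comp (hX.prodMk hY)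

theorem integrable_estimator_dotProduct (hd : 0 < d) (hf : Continuous f) (hμ : 0 < μ)
    (hL : ∀ x ∈ simplexNhd d μ, ∀ y ∈ simplexNhd d μ, |f x - f y| ≤ G * l1norm (x - y))
    (hX : Measurable X) (hY : Measurable Y) (hlaw : P.map X = unifL1Sphere d)
    (hYm : ∀ ω, Y ω ∈ stdSimplex ℝ (Fin d)) {v : Fin d → ℝ} (hv : v ∈ stdSimplex ℝ (Fin d)) :
    Integrable (fun ω => twoPointEstimator μ f (Y ω) (X ω) ⬝ᵥ (Y ω - v)) P := by
  refine Integrable.of_bound (measurable_fun_dotProduct (measurable_estimator_comp μ hf hX hY)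
    (hY.sub_const v)).aestronglyMeasurable (d * G * 2) ?_
  filter_upwards [ae_l1norm_eq_one hd hX hlaw] with ω hω
  have h1 := norm_twoPointEstimator_le hμ hL (hYm ω) hω
  exact (abs_dotProduct_le _ _).trans (mul_le_mul h1 (l1norm_sub_simplex_le (hYm ω) hv)
    (l1norm_nonneg _) ((norm_nonneg _).trans h1))

theorem integrable_norm_estimator_sq (hd : 0 < d) (hf : Continuous f) (hμ : 0 < μ)
    (hL : ∀ x ∈ simplexNhd d μ, ∀ y ∈ simplexNhd d μ, |f x - f y| ≤ G * l1norm (x - y))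
    (hX : Measurable X) (hY : Measurable Y) (hlaw : P.map X = unifL1Sphere d)
    (hYm : ∀ ω, Y ω ∈ stdSimplex ℝ (Fin d)) :
    Integrable (fun ω => ‖twoPointEstimator μ f (Y ω) (X ω)‖ ^ 2) P := by
  refine Integrable.of_bound
    ((measurable_estimator_comp μ hf hX hY).norm.pow_const 2).aestronglyMeasurable ((d * G) ^ 2) ?_
  filter_upwards [ae_l1norm_eq_one hd hX hlaw] with ω hω
  rw [Real.norm_eq_abs, abs_of_nonneg (sq_nonneg _)]
  exact pow_le_pow_left₀ (norm_nonneg _) (norm_twoPointEstimator_le hμ hL (hYm ω) hω) 2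

/-- The second moment of the estimator is of order `d`, not `d²`. -/
theorem integral_norm_estimator_sq_le (hd : 0 < d) (hf : Continuous f) (hμ : 0 < μ)
    (hL : ∀ x ∈ simplexNhd d μ, ∀ y ∈ simplexNhd d μ, |f x - f y| ≤ G * l1norm (x - y))
    (hX : Measurable X) (hY : Measurable Y) (hXY : IndepFun X Y P)
    (hlaw : P.map X = unifL1Sphere d) (hYm : ∀ ω, Y ω ∈ stdSimplex ℝ (Fin d)) :
    ∫ ω, ‖twoPointEstimator μ f (Y ω) (X ω)‖ ^ 2 ∂P ≤ 2 * d * G ^ 2 := by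
  obtain ⟨i1, e1⟩ := integral_comp_of_indepFun hX hY hXY
    (H := fun p => ‖twoPointEstimator μ f p.2 p.1‖ ^ 2)
    ((measurable_twoPointEstimator μ hf).norm.pow_const 2)
    (integrable_norm_estimator_sq hd hf hμ hL hX hY hlaw hYm)
  rw [e1, hlaw]
  rw [hlaw] at i1
  have key : ∀ y ∈ stdSimplex ℝ (Fin d),
      ∫ s, ‖twoPointEstimator μ f y s‖ ^ 2 ∂(unifL1Sphere d) ≤ 2 * d * G ^ 2 := by
    intro y hy
    have hc : Continuous fun x => f (y + μ • x) := by fun_prop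
    have h1 := integral_sq_symmetric_difference_le hd hc
      (fun a b ha hb => lipschitz_smoothing_bound hμ hL hy ha hb)
    have hcs : Continuous fun s => (d / (2 * μ)) ^ 2 * (f (y + μ • s) - f (y + μ • -s)) ^ 2 := by
      fun_prop
    obtain ⟨M, hM⟩ := (isCompact_l1norm_le (d := d) 1).exists_bound_of_continuousOn
      hcs.continuousOn
    have hint : Integrable (fun s => (d / (2 * μ)) ^ 2 * (f (y + μ • s) - f (y + μ • -s)) ^ 2)
        (unifL1Sphere d) := by
      refine Integrable.of_bound hcs.aestronglyMeasurable M ?_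
      filter_upwards [ae_unifL1Sphere_l1norm hd] with s hs using hM s hs.le
    calc ∫ s, ‖twoPointEstimator μ f y s‖ ^ 2 ∂(unifL1Sphere d)
        ≤ ∫ s, (d / (2 * μ)) ^ 2 * (f (y + μ • s) - f (y + μ • -s)) ^ 2 ∂(unifL1Sphere d) :=
          integral_mono_of_nonneg (.of_forall fun s => sq_nonneg _) hint
            (.of_forall fun s => norm_twoPointEstimator_sq_le y s)
      _ = (d / (2 * μ)) ^ 2 * ∫ s, (f (y + μ • s) - f (y + μ • -s)) ^ 2 ∂(unifL1Sphere d) :=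
          integral_const_mul _ _
      _ ≤ (d / (2 * μ)) ^ 2 * (8 * (G * μ) ^ 2 / (d + 1)) :=
          mul_le_mul_of_nonneg_left h1 (sq_nonneg _)
      _ = 2 * G ^ 2 * (d * (d / (d + 1))) := by field_simp; ring
      _ ≤ 2 * G ^ 2 * (d * 1) := by
          have : (d : ℝ) / (d + 1) ≤ 1 := by rw [div_le_one (by positivity)]; linarith
          gcongr
      _ = 2 * d * G ^ 2 := by ring
  calc _ ≤ ∫ _, 2 * d * G ^ 2 ∂P :=
        integral_mono i1 (integrable_const _) fun ω => key _ (hYm ω)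
    _ = _ := by simp

/-- The expected loss of a round, relative to a comparator `u`, is bounded by the expected
surrogate loss relative to the shrunk comparator, up to smoothing and shrinkage errors. -/
theorem integral_round_loss_le (hd : 0 < d) (hf : ConvexOn ℝ Set.univ f) (hμ : 0 < μ)
    (hμ1 : μ ≤ 1) (hG : 0 ≤ G)
    (hL : ∀ x ∈ simplexNhd d μ, ∀ y ∈ simplexNhd d μ, |f x - f y| ≤ G * l1norm (x - y))
    (hX : Measurable X) (hY : Measurable Y) (hXY : IndepFun X Y P)
    (hlaw : P.map X = unifL1Sphere d) (hYm : ∀ ω, Y ω ∈ stdSimplex ℝ (Fin d)) {u : Fin d → ℝ}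
    (hu : u ∈ stdSimplex ℝ (Fin d)) :
    ∫ ω, ((f (Y ω + μ • X ω) + f (Y ω - μ • X ω)) / 2 - f u) ∂P ≤
      ∫ ω, twoPointEstimator μ f (Y ω) (X ω) ⬝ᵥ (Y ω - shrinkPoint μ u) ∂P + 5 * (G * μ) := by
  have hfc : Continuous f := continuousOn_univ.1 (hf.continuousOn isOpen_univ)
  set v := shrinkPoint μ u with hvdef
  have hv : v ∈ stdSimplex ℝ (Fin d) := shrinkPoint_mem_stdSimplex hd hμ.le hμ1 hu
  have hH : Measurable fun p : (Fin d → ℝ) × (Fin d → ℝ) =>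
      twoPointEstimator μ f p.2 p.1 ⬝ᵥ (p.2 - v) :=
    measurable_fun_dotProduct (measurable_twoPointEstimator μ hfc) (measurable_snd.sub_const v)
  obtain ⟨i1, e1⟩ := integral_comp_of_indepFun hX hY hXY hH
    (integrable_estimator_dotProduct hd hfc hμ hL hX hY hlaw hYm hv)
  rw [e1, hlaw]
  rw [hlaw] at i1
  have i2 := integrable_round_loss hd hfc μ hX hY hlaw hYm (f u)
  have hvu : f v - f u ≤ 2 * (G * μ) := by
    have h1 := (le_abs_self _).trans
      (hL v (self_mem_simplexNhd hμ.le hv) u (self_mem_simplexNhd hμ.le hu))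
    have h2 := mul_le_mul_of_nonneg_left (l1norm_shrinkPoint_sub_self_le hd hμ.le hu) hG
    linarith
  calc ∫ ω, ((f (Y ω + μ • X ω) + f (Y ω - μ • X ω)) / 2 - f u) ∂P
      ≤ ∫ ω, ((∫ s, twoPointEstimator μ f (Y ω) s ⬝ᵥ (Y ω - v) ∂(unifL1Sphere d)) +
          5 * (G * μ)) ∂P := by
        refine integral_mono_ae i2 (i1.add (integrable_const _)) ?_
        filter_upwards [ae_l1norm_eq_one hd hX hlaw] with ω hω
        have h1 := sub_le_integral_estimator hd hf hμ hG hL (hYm ω) hv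
        change _ ≤ ∫ s, twoPointEstimator μ f (Y ω) s ⬝ᵥ (Y ω - v) ∂(unifL1Sphere d) at h1
        have h0 : l1norm (0 : Fin d → ℝ) ≤ 1 := by simp [l1norm]
        have h2 := (le_abs_self _).trans
          (lipschitz_smoothing_bound hμ hL (hYm ω) hω.le h0)
        have h3 := (le_abs_self _).trans (lipschitz_smoothing_bound hμ hL (hYm ω)
          (show l1norm (-X ω) ≤ 1 by rw [l1norm_neg]; exact hω.le) h0)
        rw [sub_zero, l1norm_neg, hω, smul_zero, add_zero, smul_neg, ← sub_eq_add_neg] at h3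
        rw [sub_zero, hω, smul_zero, add_zero] at h2
        linarith
    _ = _ := by
        rw [integral_add i1 (integrable_const _)]
        simp

end Round

/-! ### Measurability and independence of the iterates -/

namespace PBMDInput

variable {d : ℕ} {A : PBMDInput d}

theorem measurable_gradVec_comp {Ω : Type*} [MeasurableSpace Ω] {α : ℝ} (h0 : 0 < α)
    (h1 : α ≤ 1) {Y : Ω → (Fin d → ℝ)} (hY : Measurable Y)
    (hYm : ∀ ω, Y ω ∈ shrunkSimplex d α) : Measurable fun ω => gradVec negEntropy (Y ω) := by
  simp_rw [fun ω => gradVec_negEntropy (pos_of_mem_shrunkSimplex h0 h1 (hYm ω))]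
  exact measurable_pi_lambda _ fun j =>
    (Real.measurable_log.comp ((measurable_pi_apply j).comp hY)).add_const 1

/-- The iterates and weights are measurable functions of the directions sampled so far. -/
theorem IsEntropic.measurable_state (hA : A.IsEntropic) {Ω : Type*} [MeasurableSpace Ω]
    {f : ℕ → (Fin d → ℝ) → ℝ} {s : ℕ → Ω → (Fin d → ℝ)} (t : ℕ)
    (hf : ∀ i < t, Continuous (f i)) (hs : ∀ i < t, Measurable (s i)) :
    (∀ k ∈ Finset.Icc 1 A.N, Measurable fun ω => (A.state f (fun i => s i ω) t).iter k) ∧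
      ∀ k ∈ Finset.Icc 1 A.N, Measurable fun ω => (A.state f (fun i => s i ω) t).weight k := by
  induction t with
  | zero => exact ⟨fun _ _ => measurable_const, fun _ _ => measurable_const⟩
  | succ t ih =>
    obtain ⟨h1, h2⟩ := ih (fun i hi => hf i (hi.trans t.lt_succ_self))
      fun i hi => hs i (hi.trans t.lt_succ_self)
    have hst := hs t t.lt_succ_self
    have hft := hf t t.lt_succ_self
    have hcomb : Measurable fun ω => A.combine (A.state f (fun i => s i ω) t) :=
      Finset.measurable_fun_sum _ fun k hk => (h2 k hk).smul (h1 k hk)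
    have hest : Measurable fun ω =>
        A.estimator (A.state f (fun i => s i ω) t) (f t) (s t ω) :=
      measurable_estimator_comp A.μ hft hst hcomb
    have hsur : ∀ k ∈ Finset.Icc 1 A.N, Measurable fun ω =>
        Real.exp (-A.γ * A.surrogate (A.state f (fun i => s i ω) t) (f t) (s t ω)
          ((A.state f (fun i => s i ω) t).iter k)) := fun k hk =>
      Real.measurable_exp.comp ((measurable_fun_dotProduct hest ((h1 k hk).sub hcomb)).const_mul _)
    refine ⟨fun k hk => ?_, fun k hk => ?_⟩
    · have : ∀ ω, (A.state f (fun i => s i ω) (t + 1)).iter k =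
          mirrorMap d A.μ (A.stepSize k • A.estimator (A.state f (fun i => s i ω) t) (f t) (s t ω)
            - gradVec negEntropy ((A.state f (fun i => s i ω) t).iter k)) :=
        fun ω => hA.iter_step _ _ hk
      simp_rw [this]
      refine (continuous_mirrorMap hA.dim_pos hA.μ_pos hA.μ_lt_one.le).measurable.comp ?_
      exact (hest.const_smul (A.stepSize k)).sub (measurable_gradVec_comp hA.μ_pos
        hA.μ_lt_one.le (h1 k hk) fun ω => (hA.isValid_state f _ t).iter_mem k hk)
    · exact ((h2 k hk).mul (hsur k hk)).div
        (Finset.measurable_fun_sum _ fun j hj => (h2 j hj).mul (hsur j hj))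

theorem IsEntropic.measurable_combine (hA : A.IsEntropic) {Ω : Type*} [MeasurableSpace Ω]
    {f : ℕ → (Fin d → ℝ) → ℝ} {s : ℕ → Ω → (Fin d → ℝ)} (t : ℕ)
    (hf : ∀ i < t, Continuous (f i)) (hs : ∀ i < t, Measurable (s i)) :
    Measurable fun ω => A.combine (A.state f (fun i => s i ω) t) := by
  obtain ⟨h1, h2⟩ := hA.measurable_state t hf hs
  exact Finset.measurable_fun_sum _ fun k hk => (h2 k hk).smul (h1 k hk)

/-- The direction sampled in a round is independent of the combined decision in that round. -/
theorem IsEntropic.indepFun_combine (hA : A.IsEntropic) {Ω : Type*} [MeasurableSpace Ω]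
    {P : Measure Ω} {f : ℕ → (Fin d → ℝ) → ℝ} {s : ℕ → Ω → (Fin d → ℝ)} {T : ℕ}
    (hf : ∀ i < T, Continuous (f i)) (hs : ∀ i < T, Measurable (s i))
    (hind : iIndepFun (fun t : Fin T => s t) P) {t : ℕ} (ht : t < T) :
    IndepFun (s t) (fun ω => A.combine (A.state f (fun i => s i ω) t)) P := by
  -- the decision is measurable with respect to the directions of the earlier rounds
  set m : Fin T → MeasurableSpace Ω := fun i => MeasurableSpace.comap (s i) inferInstance with hm
  have hle : ∀ i, m i ≤ ‹MeasurableSpace Ω› := fun i => (hs i i.2).comap_le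
  have hdisj : Disjoint ({⟨t, ht⟩} : Set (Fin T)) {i | (i : ℕ) < t} := by
    rw [Set.disjoint_singleton_left]; simp
  have h1 := indep_iSup_of_disjoint hle (show iIndep m P from hind) hdisj
  rw [IndepFun_iff_Indep]
  refine indep_of_indep_of_le_right (indep_of_indep_of_le_left h1 ?_) ?_
  · exact le_iSup₂_of_le (⟨t, ht⟩ : Fin T) rfl le_rfl
  · refine Measurable.comap_le ?_
    refine @IsEntropic.measurable_combine d A hA Ω (⨆ i ∈ {i : Fin T | (i : ℕ) < t}, m i) f s t
      (fun i hi => hf i (hi.trans ht)) fun i hi => ?_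
    exact Measurable.mono (comap_measurable (s i))
      (le_iSup₂_of_le (f := fun i (_ : i ∈ {i : Fin T | (i : ℕ) < t}) => m i)
        (⟨i, hi.trans ht⟩ : Fin T) hi le_rfl) le_rfl

/-- The expected dynamic regret, in terms of any base learner `k`. -/
theorem IsEntropic.integral_dynamicRegret_le (hA : A.IsEntropic) {Ω : Type*} [MeasurableSpace Ω]
    {P : Measure Ω} [IsProbabilityMeasure P] {f : ℕ → (Fin d → ℝ) → ℝ}
    {s : ℕ → Ω → (Fin d → ℝ)} {T : ℕ} {G Γ : ℝ} (hG : 0 ≤ G)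
    (hΓ : ∀ x ∈ shrunkSimplex d A.μ, ‖gradVec negEntropy x‖ ≤ Γ)
    {u : ℕ → (Fin d → ℝ)} (hu : ∀ t ≤ T, u t ∈ stdSimplex ℝ (Fin d))
    (hf : ∀ t < T, ConvexOn ℝ Set.univ (f t))
    (hL : ∀ t < T, ∀ x ∈ simplexNhd d A.μ, ∀ y ∈ simplexNhd d A.μ,
      |f t x - f t y| ≤ G * l1norm (x - y))
    (hs : ∀ t < T, Measurable (s t)) (hlaw : ∀ t < T, P.map (s t) = unifL1Sphere d)
    (hind : iIndepFun (fun t : Fin T => s t) P) :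
    Integrable (fun ω => A.dynamicRegret T f u (fun t => s t ω)) P ∧
      ∀ k ∈ Finset.Icc 1 A.N, ∫ ω, A.dynamicRegret T f u (fun t => s t ω) ∂P ≤
        (bregman negEntropy (shrinkPoint A.μ (u 0)) (A.init k) +
          (negEntropy (shrinkPoint A.μ (u T)) - negEntropy (shrinkPoint A.μ (u 0))) +
          Γ * pathVariation T (fun t => shrinkPoint A.μ (u t))) / A.stepSize k +
        -Real.log (A.initState.weight k) / A.γ +
        (A.stepSize k + 4 * A.γ) * (2 * d * G ^ 2 * T) + 5 * (G * A.μ) * T := by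
  have hd := hA.dim_pos
  have hfc : ∀ t < T, Continuous (f t) := fun t ht =>
    continuousOn_univ.1 ((hf t ht).continuousOn isOpen_univ)
  set v : ℕ → (Fin d → ℝ) := fun t => shrinkPoint A.μ (u t) with hvdef
  have hv : ∀ t ≤ T, v t ∈ shrunkSimplex d A.μ := fun t ht => ⟨u t, hu t ht, rfl⟩
  set Y : ℕ → Ω → (Fin d → ℝ) := fun t ω => A.combine (A.state f (fun i => s i ω) t) with hYdef
  have hYmeas : ∀ t < T, Measurable (Y t) := fun t ht =>
    hA.measurable_combine t (fun i hi => hfc i (hi.trans ht)) fun i hi => hs i (hi.trans ht)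
  have hYmem : ∀ t ω, Y t ω ∈ stdSimplex ℝ (Fin d) := fun t ω =>
    hA.shrunk_subset (hA.isValid_state f _ t).combine_mem
  have hindep : ∀ t < T, IndepFun (s t) (Y t) P := fun t ht => hA.indepFun_combine hfc hs hind ht
  set g : ℕ → Ω → (Fin d → ℝ) := fun t ω => twoPointEstimator A.μ (f t) (Y t ω) (s t ω) with hgdef
  have hloss : ∀ t ∈ Finset.range T, Integrable (fun ω =>
      (f t (Y t ω + A.μ • s t ω) + f t (Y t ω - A.μ • s t ω)) / 2 - f t (u t)) P := fun t ht => by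
    have ht := Finset.mem_range.1 ht
    exact integrable_round_loss hd (hfc t ht) A.μ (hs t ht) (hYmeas t ht)
      (hlaw t ht) (hYmem t) _
  have hint : Integrable (fun ω => A.dynamicRegret T f u (fun t => s t ω)) P :=
    integrable_finsetSum _ hloss
  refine ⟨hint, fun k hk => ?_⟩
  have hη := hA.step_pos k hk
  have hγ := hA.γ_pos
  have hdot : ∀ t ∈ Finset.range T, Integrable (fun ω => g t ω ⬝ᵥ (Y t ω - v t)) P :=
    fun t ht => by
    have ht := Finset.mem_range.1 ht
    exact integrable_estimator_dotProduct hd (hfc t ht) hA.μ_pos (hL t ht) (hs t ht)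
      (hYmeas t ht) (hlaw t ht) (hYmem t) (hA.shrunk_subset (hv t ht.le))
  have hsq : ∀ t ∈ Finset.range T, Integrable (fun ω => ‖g t ω‖ ^ 2) P := fun t ht => by
    have ht := Finset.mem_range.1 ht
    exact integrable_norm_estimator_sq hd (hfc t ht) hA.μ_pos (hL t ht) (hs t ht)
      (hYmeas t ht) (hlaw t ht) (hYmem t)
  have h1 : ∫ ω, A.dynamicRegret T f u (fun t => s t ω) ∂P ≤
      ∫ ω, ∑ t ∈ Finset.range T, g t ω ⬝ᵥ (Y t ω - v t) ∂P + 5 * (G * A.μ) * T := by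
    have e1 : ∫ ω, A.dynamicRegret T f u (fun t => s t ω) ∂P = ∑ t ∈ Finset.range T,
        ∫ ω, ((f t (Y t ω + A.μ • s t ω) + f t (Y t ω - A.μ • s t ω)) / 2 - f t (u t)) ∂P :=
      integral_finsetSum _ hloss
    rw [e1, integral_finsetSum _ hdot]
    have e2 : 5 * (G * A.μ) * (T : ℝ) = ∑ t ∈ Finset.range T, 5 * (G * A.μ) := by
      rw [Finset.sum_const, Finset.card_range, nsmul_eq_mul, mul_comm]
    rw [e2, ← Finset.sum_add_distrib]
    refine Finset.sum_le_sum fun t ht => ?_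
    have ht := Finset.mem_range.1 ht
    exact integral_round_loss_le hd (hf t ht) hA.μ_pos hA.μ_lt_one.le hG (hL t ht) (hs t ht)
      (hYmeas t ht) (hindep t ht) (hlaw t ht) (hYmem t) (hu t ht.le)
  set B := bregman negEntropy (v 0) (A.init k) + (negEntropy (v T) - negEntropy (v 0)) +
    Γ * pathVariation T v with hB
  set W := -Real.log (A.initState.weight k) with hW
  have h2 : ∀ ω, ∑ t ∈ Finset.range T, g t ω ⬝ᵥ (Y t ω - v t) ≤
      B / A.stepSize k + W / A.γ +
        (A.stepSize k + 4 * A.γ) * ∑ t ∈ Finset.range T, ‖g t ω‖ ^ 2 := by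
    intro ω
    have m1 := hA.meta_regret f (fun i => s i ω) hk T
    have m2 := hA.base_regret f (fun i => s i ω) hk hΓ v T hv
    set Z := ∑ t ∈ Finset.range T, ‖g t ω‖ ^ 2 with hZ
    change A.γ * ∑ t ∈ Finset.range T, g t ω ⬝ᵥ
      (Y t ω - (A.state f (fun i => s i ω) t).iter k) ≤ W + 4 * A.γ ^ 2 * Z at m1
    change A.stepSize k * ∑ t ∈ Finset.range T, g t ω ⬝ᵥ
      ((A.state f (fun i => s i ω) t).iter k - v t) ≤ B + A.stepSize k ^ 2 * Z at m2
    have m1' := (le_div_iff₀' hγ).2 m1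
    have m2' := (le_div_iff₀' hη).2 m2
    have e1 : (W + 4 * A.γ ^ 2 * Z) / A.γ = W / A.γ + 4 * A.γ * Z := by field_simp
    have e2 : (B + A.stepSize k ^ 2 * Z) / A.stepSize k = B / A.stepSize k + A.stepSize k * Z := by
      field_simp
    rw [e1] at m1'
    rw [e2] at m2'
    have e3 : ∑ t ∈ Finset.range T, g t ω ⬝ᵥ (Y t ω - v t) =
        ∑ t ∈ Finset.range T, g t ω ⬝ᵥ (Y t ω - (A.state f (fun i => s i ω) t).iter k) +
        ∑ t ∈ Finset.range T, g t ω ⬝ᵥ ((A.state f (fun i => s i ω) t).iter k - v t) := by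
      rw [← Finset.sum_add_distrib]
      refine Finset.sum_congr rfl fun t _ => ?_
      rw [← dotProduct_add, sub_add_sub_cancel]
    rw [e3]
    linarith
  have h3 : ∫ ω, ∑ t ∈ Finset.range T, ‖g t ω‖ ^ 2 ∂P ≤ 2 * d * G ^ 2 * T := by
    rw [integral_finsetSum _ hsq]
    have e2 : 2 * d * G ^ 2 * (T : ℝ) = ∑ t ∈ Finset.range T, 2 * d * G ^ 2 := by
      rw [Finset.sum_const, Finset.card_range, nsmul_eq_mul, mul_comm]
    rw [e2]
    refine Finset.sum_le_sum fun t ht => ?_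
    have ht := Finset.mem_range.1 ht
    exact integral_norm_estimator_sq_le hd (hfc t ht) hA.μ_pos (hL t ht) (hs t ht)
      (hYmeas t ht) (hindep t ht) (hlaw t ht) (hYmem t)
  have hsqi := (integrable_finsetSum _ hsq).const_mul (A.stepSize k + 4 * A.γ)
  have h4 : ∫ ω, ∑ t ∈ Finset.range T, g t ω ⬝ᵥ (Y t ω - v t) ∂P ≤
      B / A.stepSize k + W / A.γ + (A.stepSize k + 4 * A.γ) * (2 * d * G ^ 2 * T) := by
    calc _ ≤ ∫ ω, (B / A.stepSize k + W / A.γ +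
          (A.stepSize k + 4 * A.γ) * ∑ t ∈ Finset.range T, ‖g t ω‖ ^ 2) ∂P :=
          integral_mono (integrable_finsetSum _ hdot) ((integrable_const _).add hsqi) h2
      _ = B / A.stepSize k + W / A.γ + (A.stepSize k + 4 * A.γ) *
          ∫ ω, ∑ t ∈ Finset.range T, ‖g t ω‖ ^ 2 ∂P := by
          rw [integral_add (integrable_const _) hsqi, integral_const_mul]
          simp
      _ ≤ _ := by gcongr
  linarith

end PBMDInput

/-! ### The constants of the parameter setting -/

theorem negEntropy_centroid {d : ℕ} (hd : 0 < d) :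
    negEntropy (fun _ : Fin d => 1 / (d : ℝ)) = -Real.log d := by
  have : (d : ℝ) ≠ 0 := by positivity
  simp [negEntropy, this]

theorem neg_log_le_negEntropy {d : ℕ} (hd : 0 < d) {x : Fin d → ℝ}
    (hx : x ∈ stdSimplex ℝ (Fin d)) : -Real.log d ≤ negEntropy x := by
  have hd' : (0 : ℝ) < d := by exact_mod_cast hd
  have h := bregman_nonneg hx (centroid_mem hd) fun _ => by positivity
  rw [bregman_negEntropy x fun _ => by positivity, Finset.sum_add_distrib,
    Finset.sum_sub_distrib, Finset.sum_sub_distrib, ← Finset.sum_mul, hx.2,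
    (centroid_mem hd).2] at h
  simp only [one_div, Real.log_inv] at h
  have : negEntropy x = ∑ i, x i * Real.log (x i) := rfl
  linarith

theorem entropyOsc_eq {d : ℕ} (hd : 0 < d) : entropyOsc d = Real.log d := by
  have h1 : IsGreatest (negEntropy '' stdSimplex ℝ (Fin d)) 0 := by
    refine ⟨⟨Pi.single ⟨0, hd⟩ 1, single_mem_stdSimplex _ _, ?_⟩, ?_⟩
    · refine Finset.sum_eq_zero fun i _ => ?_
      by_cases h : i = ⟨0, hd⟩ <;> simp [h]
    · rintro _ ⟨x, hx, rfl⟩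
      exact negEntropy_nonpos hx
  have h2 : IsLeast (negEntropy '' stdSimplex ℝ (Fin d)) (-Real.log d) := by
    refine ⟨⟨_, centroid_mem hd, negEntropy_centroid hd⟩, ?_⟩
    rintro _ ⟨x, hx, rfl⟩
    exact neg_log_le_negEntropy hd hx
  rw [entropyOsc, h1.csSup_eq, h2.csInf_eq]
  ring

theorem norm_gradVec_le {d : ℕ} {α : ℝ} (h0 : 0 < α) (h1 : α ≤ 1) (hd : 0 < d) {x : Fin d → ℝ}
    (hx : x ∈ shrunkSimplex d α) : ‖gradVec negEntropy x‖ ≤ 1 - Real.log (α / d) := by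
  have hd' : (0 : ℝ) < d := by exact_mod_cast hd
  have hα : 0 < α / d := by positivity
  rw [gradVec_negEntropy (pos_of_mem_shrunkSimplex h0 h1 hx)]
  have hlog : ∀ i, Real.log (α / d) ≤ Real.log (x i) ∧ Real.log (x i) ≤ 0 := fun i =>
    ⟨Real.log_le_log hα (le_coord_of_mem_shrunkSimplex h1 hx i),
      Real.log_nonpos (pos_of_mem_shrunkSimplex h0 h1 hx i).le
        (mem_Icc_of_mem_stdSimplex (shrunkSimplex_subset hd h0.le h1 hx) i).2⟩
  have h2 := hlog ⟨0, hd⟩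
  refine (pi_norm_le_iff_of_nonneg (by linarith)).2 fun i => ?_
  rw [Real.norm_eq_abs, abs_le]
  constructor <;> linarith [(hlog i).1, (hlog i).2]

theorem bddAbove_norm_gradVec {d : ℕ} {α : ℝ} (h0 : 0 < α) (h1 : α ≤ 1) (hd : 0 < d) :
    BddAbove ((fun x : Fin d → ℝ => ‖gradVec negEntropy x‖) '' shrunkSimplex d α) := by
  refine ⟨1 - Real.log (α / d), ?_⟩
  rintro _ ⟨x, hx, rfl⟩
  exact norm_gradVec_le h0 h1 hd hx

theorem norm_gradVec_le_entropyGradBound {d : ℕ} {α : ℝ} (h0 : 0 < α) (h1 : α ≤ 1) (hd : 0 < d)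
    {x : Fin d → ℝ} (hx : x ∈ shrunkSimplex d α) :
    ‖gradVec negEntropy x‖ ≤ entropyGradBound d α :=
  le_csSup (bddAbove_norm_gradVec h0 h1 hd) ⟨x, hx, rfl⟩

theorem entropyGradBound_le {d : ℕ} {α : ℝ} (h0 : 0 < α) (h1 : α ≤ 1) (hd : 0 < d) :
    entropyGradBound d α ≤ 1 - Real.log (α / d) := by
  refine csSup_le ((shrunkSimplex_nonempty hd α).image _) ?_
  rintro _ ⟨x, hx, rfl⟩
  exact norm_gradVec_le h0 h1 hd hx

/-- The gradient of the entropy at a shrunk vertex gives a lower bound on the gradient bound. -/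
theorem neg_log_sub_one_le_entropyGradBound {d : ℕ} {α : ℝ} (h0 : 0 < α) (h1 : α ≤ 1)
    (hd : 2 ≤ d) : -Real.log (α / d) - 1 ≤ entropyGradBound d α := by
  have hd0 : 0 < d := by omega
  set x : Fin d → ℝ := shrinkPoint α (Pi.single ⟨0, hd0⟩ 1) with hxdef
  have hx : x ∈ shrunkSimplex d α := ⟨_, single_mem_stdSimplex _ _, rfl⟩
  refine le_trans ?_ (norm_gradVec_le_entropyGradBound h0 h1 hd0 hx)
  rw [gradVec_negEntropy (pos_of_mem_shrunkSimplex h0 h1 hx)]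
  refine le_trans ?_ (norm_le_pi_norm _ (⟨1, by omega⟩ : Fin d))
  have hx1 : x ⟨1, by omega⟩ = α / d := by
    simp [hxdef, shrinkPoint, div_eq_mul_inv]
  simp only [hx1]
  rw [Real.norm_eq_abs]
  linarith [neg_abs_le (Real.log (α / d) + 1)]

theorem pathVariation_nonneg {d : ℕ} (T : ℕ) (u : ℕ → (Fin d → ℝ)) : 0 ≤ pathVariation T u :=
  Finset.sum_nonneg fun _ _ => l1norm_nonneg _

theorem pathVariation_le {d : ℕ} {T : ℕ} {u : ℕ → (Fin d → ℝ)}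
    (hu : ∀ t ≤ T, u t ∈ stdSimplex ℝ (Fin d)) : pathVariation T u ≤ 2 * T := by
  have : pathVariation T u ≤ ∑ _t ∈ Finset.range T, (2 : ℝ) :=
    Finset.sum_le_sum fun t ht => by
      have ht := Finset.mem_range.1 ht
      exact l1norm_sub_simplex_le (hu _ ht) (hu _ ht.le)
  simpa [mul_comm] using this

theorem pathVariation_shrinkPoint_le {d : ℕ} {α : ℝ} (h0 : 0 ≤ α) (h1 : α ≤ 1) (T : ℕ)
    (u : ℕ → (Fin d → ℝ)) :
    pathVariation T (fun t => shrinkPoint α (u t)) ≤ pathVariation T u := by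
  refine Finset.sum_le_sum fun t _ => ?_
  rw [shrinkPoint_sub, l1norm_smul, abs_of_nonneg (by linarith)]
  exact mul_le_of_le_one_left (l1norm_nonneg _) (by linarith)

/-- The grid of step sizes is fine and long enough to contain a learner within a factor two of
any multiple `R` of the smallest step size with `R ^ 2 ≤ X`. -/
theorem exists_grid_index {R X : ℝ} (hR : 1 ≤ R) (hRX : R ^ 2 ≤ X) :
    ∃ n : ℕ, n ≤ ⌈1 / 2 * Real.logb 2 X⌉₊ ∧ 2 ^ n ≤ R ∧ R ≤ 2 ^ (n + 1) := by
  obtain ⟨n, h1, h2⟩ := exists_nat_pow_near hR one_lt_two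
  refine ⟨n, ?_, h1, h2.le⟩
  have hX : 0 < X := by nlinarith
  have h3 : ((2 * n : ℕ) : ℝ) ≤ Real.logb 2 X := by
    rw [Real.le_logb_iff_rpow_le one_lt_two hX, Real.rpow_natCast, mul_comm, pow_mul]
    exact (pow_le_pow_left₀ (by positivity) h1 2).trans hRX
  have h4 : (n : ℝ) ≤ 1 / 2 * Real.logb 2 X := by
    push_cast at h3; linarith
  exact_mod_cast h4.trans (Nat.le_ceil _)

/-- The initial weights decay only polynomially. -/
theorem neg_log_initial_weight_le {d : ℕ} (A : PBMDInput d) (hN : 0 < A.N) {k : ℕ} (hk : 1 ≤ k) :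
    -Real.log (A.initState.weight k) ≤ 2 * k := by
  have hN' : (0 : ℝ) < A.N := by exact_mod_cast hN
  have hk' : (1 : ℝ) ≤ k := by exact_mod_cast hk
  have h1 : 1 / ((k : ℝ) * (k + 1)) ≤ A.initState.weight k := by
    simp only [PBMDInput.initState]
    refine le_mul_of_one_le_left (by positivity) ?_
    rw [le_div_iff₀ hN']; linarith
  have h2 := Real.log_le_log (by positivity) h1
  rw [one_div, Real.log_inv, Real.log_mul (by positivity) (by positivity)] at h2
  have h3 := Real.log_le_sub_one_of_pos (show (0 : ℝ) < k by linarith)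
  have h4 := Real.log_le_sub_one_of_pos (show (0 : ℝ) < (k : ℝ) + 1 by linarith)
  linarith

/-- The real-number arithmetic of the tuned bound: `q = √D R` is the size of the tuned
comparator term, `S = √(d T)`, and `e` is the smallest step size, so that `e R = q / (c G S)`. -/
theorem tuned_regret_le {a b c G S q e R η γ B W μT : ℝ} (ha : 0 < a) (hb : 0 < b)
    (hG : 0 < G) (hS : 0 < S) (hq : 1 ≤ q) (hc1 : 1 ≤ c) (hc2 : c ≤ 10)
    (he : e * R * (c * G * S) = q) (hη1 : e * R ≤ 2 * η) (hη2 : η ≤ e * R)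
    (hγ1 : a * (1 / (G * S)) ≤ γ) (hγ2 : γ ≤ b * (1 / (G * S)))
    (hB : B ≤ 2 * q ^ 2) (hW : W ≤ 2 * q) (hμ : μT ≤ b * (S * q)) :
    B / η + W / γ + (η + 4 * γ) * (2 * G ^ 2 * S ^ 2) + 5 * G * μT ≤
      (42 + 13 * b + 2 / a) * (G * S * q) := by
  have hq0 : 0 < q := by linarith
  have hGS : 0 < G * S := by positivity
  have hcGS : 0 < c * G * S := by positivity
  have heR : 0 < e * R := by
    by_contra h
    push Not at h
    nlinarith
  have hη : 0 < η := by linarith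
  have hγ : 0 < γ := lt_of_lt_of_le (by positivity) hγ1
  have t1 : B / η ≤ 40 * (G * S * q) := by
    rw [div_le_iff₀ hη]
    have h1 : q ≤ 20 * η * (G * S) := by
      have h2 : q ≤ 2 * η * (c * G * S) := by
        rw [← he]; exact mul_le_mul_of_nonneg_right hη1 hcGS.le
      have h3 : 2 * η * (c * G * S) ≤ 2 * η * (10 * G * S) := by gcongr
      linarith
    nlinarith
  have t2 : W / γ ≤ 2 / a * (G * S * q) := by
    rw [div_le_iff₀ hγ]
    have h1 : 1 ≤ γ * (G * S) / a := by
      rw [le_div_iff₀ ha]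
      have := mul_le_mul_of_nonneg_right hγ1 hGS.le
      have e1 : a * (1 / (G * S)) * (G * S) = a := by field_simp
      linarith
    have h2 : 2 / a * (G * S * q) * γ = 2 * q * (γ * (G * S) / a) := by ring
    rw [h2]
    nlinarith
  have t3 : η * (2 * G ^ 2 * S ^ 2) ≤ 2 * (G * S * q) := by
    have h1 : η * (G * S) ≤ q := by
      have h2 : η * (G * S) ≤ e * R * (G * S) := mul_le_mul_of_nonneg_right hη2 hGS.le
      have h3 : e * R * (1 * G * S) ≤ e * R * (c * G * S) := by gcongr
      linarith
    have := mul_le_mul_of_nonneg_right h1 hGS.le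
    nlinarith
  have t4 : 4 * γ * (2 * G ^ 2 * S ^ 2) ≤ 8 * b * (G * S * q) := by
    have h1 : γ * (G * S) ≤ b := by
      have := mul_le_mul_of_nonneg_right hγ2 hGS.le
      have e1 : b * (1 / (G * S)) * (G * S) = b := by field_simp
      linarith
    have h2 := mul_le_mul_of_nonneg_right h1 hGS.le
    have h3 : b * (G * S) ≤ b * (G * S * q) := by
      have : G * S ≤ G * S * q := le_mul_of_one_le_right hGS.le hq
      gcongr
    nlinarith
  have t5 : 5 * G * μT ≤ 5 * b * (G * S * q) := by
    have := mul_le_mul_of_nonneg_left hμ (show 0 ≤ 5 * G by positivity)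
    linarith
  linarith

/-- Up to constants, the tuned comparator term is bounded by the logarithmic factors of the
dimension and of the horizon. -/
theorem tuned_size_le {a κ μ L τ ℓ D Γ p : ℝ} (hκ : 1 ≤ κ)
    (hL : 1 ≤ L) (hτ : 1 / 2 ≤ τ) (hp : 0 ≤ p) (hℓ : ℓ = L - Real.log μ)
    (hlog : Real.log a - τ / 2 ≤ Real.log μ) (hD : D ≤ κ * (L + ℓ)) (hΓ : Γ ≤ 1 + ℓ) :
    D + Γ * (1 + p) / 2 ≤ (κ + 1) * (5 + 2 * |Real.log a|) * (L * τ * (1 + p)) := by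
  have hA := neg_abs_le (Real.log a)
  have hA0 := abs_nonneg (Real.log a)
  set A0 := |Real.log a|
  have hx : 1 / 2 ≤ L * τ := by nlinarith
  have hLx : L ≤ 2 * (L * τ) := by nlinarith
  have hτx : τ ≤ L * τ := by nlinarith
  have hAx : A0 ≤ 2 * A0 * (L * τ) := by nlinarith
  set x := L * τ
  have hℓx : ℓ ≤ (3 + 2 * A0) * x := by nlinarith
  have h1 : L + ℓ ≤ (5 + 2 * A0) * x := by nlinarith
  have h2 : Γ ≤ (5 + 2 * A0) * x := by nlinarith
  set y := (5 + 2 * A0) * x with hy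
  have hy0 : 0 < y := by positivity
  have h3 : D ≤ κ * y := hD.trans (mul_le_mul_of_nonneg_left h1 (by linarith))
  have h4 : D ≤ κ * y * (1 + p) := h3.trans (le_mul_of_one_le_right (by positivity) (by linarith))
  have h5 : Γ * (1 + p) ≤ y * (1 + p) := mul_le_mul_of_nonneg_right h2 (by linarith)
  have h6 : 0 ≤ y * (1 + p) := by positivity
  have e1 : (κ + 1) * (5 + 2 * A0) * (x * (1 + p)) = κ * y * (1 + p) + y * (1 + p) := by
    rw [hy]; ring
  rw [e1]
  linarith

theorem bregman_shrinkPoint_nonneg_and_le {d : ℕ} {α : ℝ} (h0 : 0 < α) (h1 : α ≤ 1) (hd : 0 < d)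
    {x y : Fin d → ℝ} (hx : x ∈ stdSimplex ℝ (Fin d)) (hy : y ∈ shrunkSimplex d α) :
    0 ≤ bregman negEntropy (shrinkPoint α x) y ∧
      bregman negEntropy (shrinkPoint α x) y ≤ -Real.log (α / d) := by
  have hdR : (0 : ℝ) < d := by exact_mod_cast hd
  have hx' := shrinkPoint_mem_stdSimplex hd h0.le h1 hx
  have hy' := shrunkSimplex_subset hd h0.le h1 hy
  exact ⟨bregman_nonneg hx' hy' (pos_of_mem_shrunkSimplex h0 h1 hy),
    bregman_le_neg_log (by positivity) hx' hy' (le_coord_of_mem_shrunkSimplex h1 hy)⟩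

namespace SimplexSetting

variable {a b κ : ℝ} {d T : ℕ} {G D : ℝ} {u₁ : Fin d → ℝ} {A : PBMDInput d}

theorem N_pos (hA : SimplexSetting a b κ T G D u₁ A) : 0 < A.N := by
  rw [hA.num]; exact Nat.succ_pos _

/-- The value `D` lies between `log d` and a multiple of the largest possible gap. -/
theorem gap_bounds (hA : SimplexSetting a b κ T G D u₁ A) (hκ : 0 ≤ κ) (hd : 0 < d)
    (hu : u₁ ∈ stdSimplex ℝ (Fin d)) :
    Real.log d ≤ D ∧ D ≤ κ * (Real.log d + -Real.log (A.μ / d)) := by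
  have hgap := bregman_shrinkPoint_nonneg_and_le hA.μ_pos hA.μ_lt_one.le hd hu
    (PBMDInput.isValid_initState hA.N_pos hA.init_mem).combine_mem
  have h1 := hA.gap_le
  have h2 := hA.le_gap
  rw [initialGap, entropyOsc_eq hd] at h1 h2
  exact ⟨by linarith [hgap.1],
    h2.trans (mul_le_mul_of_nonneg_left (by linarith [hgap.2]) hκ)⟩

theorem isEntropic (hA : SimplexSetting a b κ T G D u₁ A) (ha : 0 < a) (hG : 0 < G) (hd : 0 < d)
    (hT : 0 < T) (hD : 0 < D) : A.IsEntropic where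
  dim_pos := hd
  mirror := hA.mirror
  μ_pos := hA.μ_pos
  μ_lt_one := hA.μ_lt_one
  dom := hA.dom
  N_pos := hA.N_pos
  γ_pos := lt_of_lt_of_le (by positivity) hA.γ_lower
  init_mem := hA.init_mem
  step_pos := fun k hk => by rw [hA.steps k hk]; positivity

end SimplexSetting

theorem sqrt_smallest_step_mul {c G d T : ℝ} (hc : 0 < c) (hG : 0 < G) (hd : 0 < d)
    (hT : 0 < T) (D : ℝ) :
    √(D / (c * G ^ 2 * d * T)) * (√c * G * √(d * T)) = √D := by
  have h2 : √c * G * √(d * T) = √(c * G ^ 2 * d * T) := by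
    rw [mul_assoc _ d T, Real.sqrt_mul (x := c * G ^ 2) (by positivity), Real.sqrt_mul hc.le,
      Real.sqrt_sq hG.le]
  rw [h2, ← Real.sqrt_mul' _ (by positivity), div_mul_cancel₀ _ (by positivity)]

theorem sqrt_mul_div_mul_self {D d T : ℝ} (hD : 0 ≤ D) (hT : 0 < T) :
    √(D * d / T) * T = √D * √(d * T) := by
  have h1 : T = √(T ^ 2) := (Real.sqrt_sq hT.le).symm
  calc √(D * d / T) * T = √(D * d / T) * √(T ^ 2) := by rw [← h1]
    _ = √D * √(d * T) := by
      rw [← Real.sqrt_mul' _ (by positivity), ← Real.sqrt_mul hD]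
      congr 1
      field_simp

/-- The lower bound on the smoothing parameter makes `log (1 / μ)` at most logarithmic in `T`. -/
theorem log_smoothing_ge {a μ D d T : ℝ} (ha : 0 < a) (hD : 1 ≤ D) (hd : 1 ≤ d) (hT : 1 ≤ T)
    (hμ : a * min 1 (√(D * d / T)) ≤ μ) : Real.log a - Real.log T / 2 ≤ Real.log μ := by
  have h1 : √(T⁻¹) ≤ min 1 (√(D * d / T)) := by
    refine le_min ?_ (Real.sqrt_le_sqrt ?_)
    · exact Real.sqrt_le_one.2 (inv_le_one_of_one_le₀ hT)
    · rw [div_eq_mul_inv]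
      exact le_mul_of_one_le_left (by positivity) (by nlinarith)
  have h3 := Real.log_le_log (by positivity) ((mul_le_mul_of_nonneg_left h1 ha.le).trans hμ)
  rw [Real.log_mul ha.ne' (by positivity), Real.log_sqrt (by positivity), Real.log_inv] at h3
  linarith

theorem sqrt_step_constant_bounds : 1 ≤ √(6 * (1 + √2) ^ 2) ∧ √(6 * (1 + √2) ^ 2) ≤ 10 := by
  have h0 := Real.sqrt_nonneg 2
  have h1 : √2 ≤ 3 / 2 := by rw [Real.sqrt_le_left (by norm_num)]; norm_num
  rw [Real.one_le_sqrt, Real.sqrt_le_left (by norm_num)]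
  constructor <;> nlinarith

end

theorem mainTheorem3 (a b κ : ℝ) (ha : 0 < a) (hab : a ≤ b) (hκ : 1 ≤ κ) :
    ∃ C : ℝ, 0 < C ∧
      ∀ (d T : ℕ), 3 ≤ d → 2 ≤ T →
      ∀ (G D : ℝ), 0 < G →
      ∀ (u : ℕ → (Fin d → ℝ)), (∀ t ≤ T, u t ∈ stdSimplex ℝ (Fin d)) →
      ∀ (A : PBMDInput d), SimplexSetting a b κ T G D (u 0) A →
      ∀ (f : ℕ → (Fin d → ℝ) → ℝ),
        (∀ t < T, ConvexOn ℝ Set.univ (f t)) →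
        (∀ t < T, ∀ x ∈ simplexNhd d A.μ, ∀ y ∈ simplexNhd d A.μ,
          |f t x - f t y| ≤ G * l1norm (x - y)) →
      ∀ (Ω : Type*) [MeasurableSpace Ω] (P : Measure Ω) [IsProbabilityMeasure P]
        (s : ℕ → Ω → (Fin d → ℝ)),
        (∀ t < T, Measurable (s t)) →
        (∀ t < T, P.map (s t) = unifL1Sphere d) →
        iIndepFun (fun t : Fin T => s t) P →
        Integrable (fun ω => A.dynamicRegret T f u (fun t => s t ω)) P ∧
        ∫ ω, A.dynamicRegret T f u (fun t => s t ω) ∂P ≤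
          C * (G * √(d * Real.log d * T * Real.log T * (1 + pathVariation T u))) := by
  have hb : 0 < b := ha.trans_le hab
  refine ⟨(42 + 13 * b + 2 / a) * √((κ + 1) * (5 + 2 * |Real.log a|)), by positivity, ?_⟩
  intro d T hd hT G D hG u hu A hA f hf hL Ω _ P _ s hs hlaw hind
  have hd0 : 0 < d := by omega
  have hdR : (0 : ℝ) < d := by exact_mod_cast hd0
  have hTR : (0 : ℝ) < T := by exact_mod_cast (show 0 < T by omega)
  have hμ0 := hA.μ_pos
  have hμ1 := hA.μ_lt_one.le
  set L := Real.log d with hLdef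
  set ℓ := -Real.log (A.μ / d) with hℓdef
  set Γ := entropyGradBound d A.μ with hΓdef
  set p := pathVariation T u with hpdef
  have hLone : 1 ≤ L := by
    rw [hLdef, Real.le_log_iff_exp_le hdR]
    have : (3 : ℝ) ≤ d := by exact_mod_cast hd
    linarith [Real.exp_one_lt_d9]
  have hτ : 1 / 2 ≤ Real.log T := by
    have h1 : Real.log 2 ≤ Real.log T := Real.log_le_log two_pos (by exact_mod_cast hT)
    linarith [Real.log_two_gt_d9]
  have hsub := shrunkSimplex_subset hd0 hμ0.le hμ1
  have hv : ∀ t ≤ T, shrinkPoint A.μ (u t) ∈ shrunkSimplex d A.μ := fun t ht => ⟨_, hu t ht, rfl⟩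
  obtain ⟨hDL, hDℓ⟩ := hA.gap_bounds (by linarith) hd0 (hu 0 (Nat.zero_le _))
  have hD1 : 1 ≤ D := hLone.trans hDL
  have hD0 : 0 < D := by linarith
  have hE : A.IsEntropic := hA.isEntropic ha hG hd0 (by omega) hD0
  obtain ⟨hint, hreg⟩ := hE.integral_dynamicRegret_le hG.le
    (fun x hx => norm_gradVec_le_entropyGradBound hμ0 hμ1 hd0 hx) hu hf hL hs hlaw hind
  refine ⟨hint, ?_⟩
  have hp0 : 0 ≤ p := pathVariation_nonneg T u
  have hΓ1 : Γ ≤ 1 + ℓ := by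
    have := entropyGradBound_le hμ0 hμ1 hd0
    linarith
  have hΓ2 : ℓ - 1 ≤ Γ := neg_log_sub_one_le_entropyGradBound hμ0 hμ1 (by omega)
  have hΓ0 : 0 ≤ Γ :=
    (norm_nonneg _).trans (norm_gradVec_le_entropyGradBound hμ0 hμ1 hd0 (hv 0 (Nat.zero_le _)))
  -- The gap `D` only controls the divergence from the combined initial point, and single base
  -- learners may start much further away. As that divergence is at most `1 + Γ`, the comparator
  -- term of every base learner is at most `2 * Q`.
  set Q := D + Γ * (1 + p) / 2 with hQdef
  -- The learner is chosen with step size within a factor two of `R` times the smallest one, which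
  -- balances `Q / η` with the second-order term.
  set R := √(1 + Γ * (1 + p) / (2 * D)) with hRdef
  have hR2 : R ^ 2 = 1 + Γ * (1 + p) / (2 * D) := Real.sq_sqrt (by positivity)
  have hDR : D * R ^ 2 = Q := by rw [hR2, hQdef]; field_simp
  have hR1 : 1 ≤ R := by
    rw [hRdef, Real.one_le_sqrt]
    have : 0 ≤ Γ * (1 + p) / (2 * D) := by positivity
    linarith
  have hRX : R ^ 2 ≤ 1 + 2 * Γ * T / D := by
    rw [hR2]
    have h1 : 1 + p ≤ 4 * T := by
      have := pathVariation_le hu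
      have : (2 : ℝ) ≤ T := by exact_mod_cast hT
      linarith
    have h2 : Γ * (1 + p) / (2 * D) ≤ Γ * (4 * T) / (2 * D) := by gcongr
    have h3 : Γ * (4 * T) / (2 * D) = 2 * Γ * T / D := by field_simp; ring
    linarith
  obtain ⟨n, hn, hnR, hRn⟩ := exists_grid_index hR1 hRX
  have hk : n + 1 ∈ Finset.Icc 1 A.N := by
    have hnum : A.N = ⌈1 / 2 * Real.logb 2 (1 + 2 * Γ * T / D)⌉₊ + 1 := hA.num
    rw [Finset.mem_Icc, hnum]; exact ⟨by omega, by omega⟩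
  have hmain := hreg (n + 1) hk
  have hsteps := hA.steps (n + 1) hk
  rw [Nat.add_sub_cancel] at hsteps
  set η := A.stepSize (n + 1)
  set e := √(D / (6 * (1 + √2) ^ 2 * G ^ 2 * d * T)) with hedef
  set S := √((d : ℝ) * T) with hSdef
  set c := √(6 * (1 + √2) ^ 2) with hcdef
  have hS2 : S ^ 2 = d * T := Real.sq_sqrt (by positivity)
  have hSpos : 0 < S := by positivity
  have hq : √Q = √D * R := by
    rw [← hDR, Real.sqrt_mul hD0.le, Real.sqrt_sq (by linarith)]
  have hsqD : 1 ≤ √D := by rw [Real.one_le_sqrt]; exact hD1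
  have heq : e * R * (c * G * S) = √Q := by
    have h1 : e * (c * G * S) = √D := sqrt_smallest_step_mul (by positivity) hG hdR hTR D
    rw [hq, ← h1]; ring
  obtain ⟨hc1, hc2⟩ : 1 ≤ c ∧ c ≤ 10 := sqrt_step_constant_bounds
  have he0 : 0 ≤ e := Real.sqrt_nonneg _
  have hRq : R ≤ √Q := by rw [hq]; exact le_mul_of_one_le_left (by linarith) hsqD
  have hDq : √D ≤ √Q := by rw [hq]; exact le_mul_of_one_le_right (by linarith) hR1
  have hW : -Real.log (A.initState.weight (n + 1)) ≤ 2 * √Q := by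
    have h1 := neg_log_initial_weight_le A hE.N_pos (Nat.succ_pos n)
    -- the index is logarithmic in `R`, so this crude bound loses nothing of importance
    have h2 : ((n + 1 : ℕ) : ℝ) ≤ 2 ^ n := by exact_mod_cast Nat.lt_two_pow_self
    have h3 : ((n + 1 : ℕ) : ℝ) ≤ √Q := (h2.trans hnR).trans hRq
    exact h1.trans (by linarith)
  set B := bregman negEntropy (shrinkPoint A.μ (u 0)) (A.init (n + 1)) +
    (negEntropy (shrinkPoint A.μ (u T)) - negEntropy (shrinkPoint A.μ (u 0))) +
    Γ * pathVariation T (fun t => shrinkPoint A.μ (u t)) with hBdef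
  have hB : B ≤ 2 * √Q ^ 2 := by
    rw [Real.sq_sqrt (by positivity)]
    have h1 := (bregman_shrinkPoint_nonneg_and_le hμ0 hμ1 hd0 (hu 0 (Nat.zero_le _))
      (hA.init_mem _ hk)).2
    have h2 := negEntropy_nonpos (hsub (hv T le_rfl))
    have h3 := neg_log_le_negEntropy hd0 (hsub (hv 0 (Nat.zero_le _)))
    have h4 := mul_le_mul_of_nonneg_left (pathVariation_shrinkPoint_le hμ0.le hμ1 T u) hΓ0
    rw [hBdef, hQdef]
    linarith
  have hμT : A.μ * T ≤ b * (S * √Q) := by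
    have h1 : √(D * d / T) * T = √D * S := sqrt_mul_div_mul_self hD0.le hTR
    calc A.μ * T ≤ b * √(D * d / T) * T := mul_le_mul_of_nonneg_right hA.μ_upper hTR.le
      _ = b * (S * √D) := by rw [mul_assoc, h1]; ring
      _ ≤ b * (S * √Q) := by gcongr
  have hη1 : e * R ≤ 2 * η := by
    have := mul_le_mul_of_nonneg_left hRn he0
    rw [pow_succ] at this
    rw [hsteps]
    linarith
  have hη2 : η ≤ e * R := by
    rw [hsteps, mul_comm]
    exact mul_le_mul_of_nonneg_left hnR he0
  have htuned := tuned_regret_le ha hb hG hSpos (hsqD.trans hDq) hc1 hc2 heq hη1 hη2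
    hA.γ_lower hA.γ_upper hB hW hμT
  rw [hS2] at htuned
  have hlogμ : Real.log a - Real.log T / 2 ≤ Real.log A.μ :=
    log_smoothing_ge ha hD1 (by exact_mod_cast hd0)
      (by exact_mod_cast (show 1 ≤ T by omega)) hA.μ_lower
  have hsize : Q ≤ (κ + 1) * (5 + 2 * |Real.log a|) * (L * Real.log T * (1 + p)) :=
    tuned_size_le hκ hLone hτ hp0
      (by rw [Real.log_div hμ0.ne' hdR.ne']; ring) hlogμ hDℓ hΓ1
  have hfinal : S * √Q ≤ √((κ + 1) * (5 + 2 * |Real.log a|)) *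
      √(d * L * T * Real.log T * (1 + p)) := by
    rw [hSdef, ← Real.sqrt_mul (by positivity), ← Real.sqrt_mul (by positivity)]
    refine Real.sqrt_le_sqrt ?_
    calc (d : ℝ) * T * Q ≤ d * T *
          ((κ + 1) * (5 + 2 * |Real.log a|) * (L * Real.log T * (1 + p))) := by gcongr
      _ = _ := by ring
  calc _ ≤ _ := hmain
    _ = B / η + -Real.log (A.initState.weight (n + 1)) / A.γ +
        (η + 4 * A.γ) * (2 * G ^ 2 * (d * T)) + 5 * G * (A.μ * T) := by ring
    _ ≤ (42 + 13 * b + 2 / a) * (G * S * √Q) := htuned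
    _ = (42 + 13 * b + 2 / a) * (G * (S * √Q)) := by ring
    _ ≤ (42 + 13 * b + 2 / a) * (G * (√((κ + 1) * (5 + 2 * |Real.log a|)) *
        √(d * L * T * Real.log T * (1 + p)))) := by gcongr
    _ = _ := by ring
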